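/- Assume the Riemann Hypothesis. Write $\log^{+}u=\max\{0,\log u\}$ for $u>0$, let $\gamma$ be the Euler–Mascheroni constant, and let $M(x)=\sum_{n\le x}\mu(n)$ be the Mertens function. Let $0<C_1\le 1$, $0<C_2\le 2C_1$, $C_3\ge 1$, and let $\sigma_0,T_1,T_2$ be real numbers with $$\frac12+\frac{C_2}{\log\log T_1}\le\sigma_0<1,$$ $$T_1\ge\max\left\{\exp\left(e^{2C_2}\right),\ \exp\left(e^{2}\right),\ C_3,\ \exp\left(\exp\left(\frac{1}{2\sigma_0-1}\right)\right)\right\},$$ $$T_1-C_3\log\log T_1-\frac12\ \ge\ T_2\ \ge\ \exp\left(e^2\right),\qquad T_1-2C_3\log\log T_1\ge 0.$$ Define $$K=\frac14+\frac{C_1}{2\log\log T_2}+\left(1+\frac{2C_1}{\log\log T_2}\right)\left(\frac{\log\log T_2}{\log T_2}+\frac{1}{\log T_2}\left(\log\log\log T_2+\log\frac1{C_1}+\frac{\gamma C_1}{\log\log T_2}\right)\right),$$ $$b_\zeta=K\left(1+\frac{\log\left(1+\frac{C_3\log\log T_1+3/2}{T_1}\right)}{\log T_1}\right)\left(1+\frac{\log\left(1+\frac{1}{\log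 T_1}\log\left(1+\frac{2C_3\log\log T_1+1}{T_1}\right)\right)}{\log\log T_1}\right),$$ $$\mathcal R=\left(2C_2+\frac1{2C_3}\right)\left(1-\frac{1}{4C_3\log\log T_1}\right)^{-1},$$ $$\varepsilon_0=\frac1{C_2}\,b_\zeta^{2(1-\sigma_0)}\exp\left(\left(1+\frac{\log^{+}b_\zeta}{\log\log T_1}\right)\mathcal R\right)\frac{\log\log T_1}{(\log T_1)^{2\sigma_0-1}}.$$ Let $\lambda\in(0,T_1]$. If $\varepsilon_0<1$, then the integral below converges, and $$|M(x)|\le 1+\left(\frac1{\pi\sigma_0}\left(1+\frac{\lambda}{T_1}\right)^{\sigma_0}\int_0^{T_1}\frac{du}{|\zeta(\sigma_0+iu)|}\right)x^{\sigma_0}+\left(1+\frac{\lambda^{\varepsilon_0}}{\pi}\left(1+\frac{\lambda}{T_1}\right)^{\sigma_0}\left(\frac1{\varepsilon_0}+\frac{2}{\lambda(1-\varepsilon_0)}\left(1+\frac{\lambda}{T_1}\right)\right)\right)x^{\frac{\sigma_0+\varepsilon_0}{1+\varepsilon_0}}$$ for all real $x\ge\left(T_1/\lambda\right)^{(1+\varepsilon_0)/(1-\sigma_0)}$.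 -/

import Mathlib

noncomputable section

/-- The Mertens function `M(x) = ∑_{n ≤ x} μ(n)` of a real variable. -/
def mertens (x : ℝ) : ℝ :=
  ∑ n ∈ Finset.Icc 1 ⌊x⌋₊, (ArithmeticFunction.moebius n : ℝ)

/-- The quantity `K(d, m, ℓ, C, C₁, t)`; here `γ` is the Euler–Mascheroni constant and
`Real.posLog u = max 0 (log u)`. -/
def convexityK (d m ℓ C C₁ t : ℝ) : ℝ :=
  d / 4 + C₁ * d / (2 * Real.log (Real.log t)) +
    (1 + 2 * C₁ / Real.log (Real.log t)) *
      (ℓ * Real.log (Real.log t) / Real.log t +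
        m / Real.log t *
          (Real.log (Real.log (Real.log t)) + Real.log (1 / C₁) +
            Real.eulerMascheroniConstant * C₁ / Real.log (Real.log t)) +
        Real.posLog C / Real.log t)

/-- The quantity `b₁(d, m, ℓ, C, C₁, C₃, T₁, T₂)`. -/
def bOne (d m ℓ C C₁ C₃ T₁ T₂ : ℝ) : ℝ :=
  1 / m * convexityK d m ℓ C C₁ T₂ *
    (1 + Real.log (1 + (C₃ * Real.log (Real.log T₁) + 3 / 2) / T₁) / Real.log T₁) *
    (1 + Real.log (1 + 1 / Real.log T₁ *
        Real.log (1 + (2 * C₃ * Real.log (Real.log T₁) + 1) / T₁)) /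
      Real.log (Real.log T₁))

/-- The value `b_ζ(C₁, C₃, T₁, T₂)` of `bOne` for the Riemann zeta-function. -/
def bZeta (C₁ C₃ T₁ T₂ : ℝ) : ℝ := bOne 1 1 1 1 C₁ C₃ T₁ T₂

/-- The quantity `ℛ(C₂, C₃, T₁)`. -/
def calR (C₂ C₃ T₁ : ℝ) : ℝ :=
  (2 * C₂ + 1 / (2 * C₃)) * (1 - 1 / (4 * C₃ * Real.log (Real.log T₁)))⁻¹

/-- The exponent `ε₀`. -/
def epsZero (σ₀ C₁ C₂ C₃ T₁ T₂ : ℝ) : ℝ :=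
  1 / C₂ * bZeta C₁ C₃ T₁ T₂ ^ (2 * (1 - σ₀)) *
    Real.exp ((1 + Real.posLog (bZeta C₁ C₃ T₁ T₂) / Real.log (Real.log T₁)) * calR C₂ C₃ T₁) *
    (Real.log (Real.log T₁) / Real.log T₁ ^ (2 * σ₀ - 1))

end

open Complex Filter Topology Set MeasureTheory


/-! The proof combines a pointwise bound for `1/ζ` to the right of `Re s = 1/2` with a smoothed
Perron formula.

Under RH, `ζ` has a holomorphic logarithm `f` on the quadrant `Re s > 1/2`, `Im s > 0`. An
elementary Euler–Maclaurin estimate bounds `|ζ|`, hence `Re f`, from above; a refined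
Borel–Carathéodory argument turns this into `|f| ≤ K log(t + 1) / δ` on `Re s ≥ 1/2 + δ`
(`IsLogZeta.norm_le_convexityK`). On `Re s ≥ 1 + δ` the Dirichlet series gives `|f| ≤ 1/δ`.
Hadamard's three circles theorem, with centre far to the right, interpolates between the two bounds
(`IsLogZeta.norm_le_three_circles`). With `δ = C₂ / log log T` and inner radius `C₃ log log T` this
becomes `|f(σ + iT)| ≤ ε₀ log T`, so `1/|ζ(σ + it)| ≤ t ^ ε₀` for `σ ≥ σ₀`, `t ≥ T₁`
(`RiemannHypothesis.norm_inv_riemannZeta_le`).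

For the Mertens function, put `S(X) = ∑_{n ≤ X} μ(n)(X - n)`. Perron's formula for `S` has the
kernel `1/(s(s+1))` and converges absolutely. As `ε₀ < 1`, the line of integration moves to `Re s =
σ₀` (`RiemannHypothesis.integral_perronIntegrand`). The difference `S(x + h) - S(x)` is `h M(x)` up
to `h(h + 1)`, and its integral is split at `T₁` and `T`: below `T₁` the integral of `1/|ζ|` is
kept, above it the power bound applies. Finally `h` and `T` are chosen so that `hT = λx` and `x ^ σ₀
T ^ ε₀ = λ ^ ε₀ h`, which gives the short-interval error and both upper ranges the same order after
division by `h`. -/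

/-! ### Euler–Maclaurin summation and an upper bound for `ζ` -/

/-- The difference is `-s ∫ x ^ (-s - 1)`; taking norms inside leaves a real integral that is
evaluated exactly. -/
lemma norm_cpow_neg_sub_le {a b : ℝ} (ha : 0 < a) (hab : a ≤ b) {s : ℂ} (hs : 0 < s.re) :
    ‖(b : ℂ) ^ (-s) - (a : ℂ) ^ (-s)‖ ≤ ‖s‖ / s.re * (a ^ (-s.re) - b ^ (-s.re)) := by
  have hs0 : s ≠ 0 := by rintro rfl; simp at hs
  have h0 : (0 : ℝ) ∉ uIcc a b := by
    rw [uIcc_of_le hab]; exact fun h => absurd h.1 (not_le.mpr ha)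
  have h1 : ∫ x in a..b, (x : ℂ) ^ (-s - 1) = ((b : ℂ) ^ (-s) - (a : ℂ) ^ (-s)) / (-s) := by
    rw [integral_cpow (Or.inr ⟨by
      intro h; apply hs0; linear_combination -h, h0⟩)]
    simp
  have h2 : ∫ x in a..b, x ^ (-s.re - 1) = (b ^ (-s.re) - a ^ (-s.re)) / (-s.re) := by
    rw [integral_rpow (Or.inr ⟨by linarith, h0⟩)]
    simp
  have h3 : ‖∫ x in a..b, (x : ℂ) ^ (-s - 1)‖ ≤ ∫ x in a..b, x ^ (-s.re - 1) := by
    refine (intervalIntegral.norm_integral_le_integral_norm hab).trans (le_of_eq ?_)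
    refine intervalIntegral.integral_congr fun x hx => ?_
    rw [uIcc_of_le hab] at hx
    rw [norm_cpow_eq_rpow_re_of_pos (ha.trans_le hx.1)]
    simp
  rw [h1, h2, norm_div, norm_neg, div_le_iff₀ (norm_pos_iff.mpr hs0)] at h3
  refine h3.trans (le_of_eq ?_)
  field_simp
  ring

lemma rpow_neg_sub_le {a σ : ℝ} (ha : 0 < a) (hσ : 0 < σ) :
    a ^ (-σ) - (a + 1) ^ (-σ) ≤ σ * a ^ (-σ - 1) := by
  have h0 : (0 : ℝ) ∉ uIcc a (a + 1) := by
    rw [uIcc_of_le (by linarith)]; exact fun h => absurd h.1 (not_le.mpr ha)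
  have h2 : ∫ x in a..(a + 1), x ^ (-σ - 1) = ((a + 1) ^ (-σ) - a ^ (-σ)) / (-σ) := by
    rw [integral_rpow (Or.inr ⟨by linarith, h0⟩)]
    simp
  have h3 : ‖∫ x in a..(a + 1), x ^ (-σ - 1)‖ ≤ a ^ (-σ - 1) * |a + 1 - a| := by
    refine intervalIntegral.norm_integral_le_of_norm_le_const fun x hx => ?_
    rw [uIoc_of_le (by linarith)] at hx
    rw [Real.norm_of_nonneg (by have := ha.trans hx.1; positivity)]
    exact Real.rpow_le_rpow_of_nonpos ha hx.1.le (by linarith)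
  rw [h2] at h3
  have h4 := (le_abs_self _).trans h3
  rw [add_sub_cancel_left, abs_one, mul_one, div_neg, ← neg_div, div_le_iff₀ hσ] at h4
  linarith

/-- The error made on `[x, x + 1]` when the integral of `u ^ (-s)` is replaced by the value at the
right end point. -/
noncomputable def rightEndpointError (s : ℂ) (x : ℝ) : ℂ :=
  ((x + 1 : ℝ) : ℂ) ^ (-s) - (((x + 1 : ℝ) : ℂ) ^ (1 - s) - (x : ℂ) ^ (1 - s)) / (1 - s)

/-- The error is the integral of `(x + 1) ^ (-s) - u ^ (-s)`. The bound is kept as a difference so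
that it telescopes when summed over consecutive integers. -/
lemma norm_rightEndpointError_le {x : ℝ} (hx : 0 < x) {s : ℂ} (hs : 0 < s.re) (hs1 : s ≠ 1) :
    ‖rightEndpointError s x‖ ≤ ‖s‖ / s.re * (x ^ (-s.re) - (x + 1) ^ (-s.re)) := by
  have h0 : (0 : ℝ) ∉ uIcc x (x + 1) := by
    rw [uIcc_of_le (by linarith)]; exact fun h => absurd h.1 (not_le.mpr hx)
  have h1 : ∫ u in x..(x + 1), (u : ℂ) ^ (-s) =
      (((x + 1 : ℝ) : ℂ) ^ (1 - s) - (x : ℂ) ^ (1 - s)) / (1 - s) := by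
    rw [integral_cpow (Or.inr ⟨by simpa [neg_inj] using hs1, h0⟩)]
    rw [show -s + 1 = 1 - s by ring]
  have hint : IntervalIntegrable (fun u : ℝ => (u : ℂ) ^ (-s)) MeasureTheory.volume x (x + 1) :=
    intervalIntegral.intervalIntegrable_cpow (Or.inr h0)
  have h2 : rightEndpointError s x =
      ∫ u in x..(x + 1), (((x + 1 : ℝ) : ℂ) ^ (-s) - (u : ℂ) ^ (-s)) := by
    rw [intervalIntegral.integral_sub (by simp) hint, h1]
    simp [rightEndpointError]
  rw [h2]
  refine (intervalIntegral.norm_integral_le_of_norm_le_const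
    (C := ‖s‖ / s.re * (x ^ (-s.re) - (x + 1) ^ (-s.re))) fun u hu => ?_).trans (by simp)
  rw [uIoc_of_le (by linarith)] at hu
  refine (norm_cpow_neg_sub_le (hx.trans hu.1) hu.2 hs).trans ?_
  have := Real.rpow_le_rpow_of_nonpos hx hu.1.le (by linarith : -s.re ≤ 0)
  gcongr

lemma sum_rightEndpointError (s : ℂ) (N K : ℕ) :
    ∑ k ∈ Finset.range K, rightEndpointError s ((N + k : ℕ) : ℝ) =
      ∑ i ∈ Finset.range (N + K), 1 / ((i : ℂ) + 1) ^ s -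
        ∑ i ∈ Finset.range N, 1 / ((i : ℂ) + 1) ^ s -
        (((N + K : ℕ) : ℂ) ^ (1 - s) - (N : ℂ) ^ (1 - s)) / (1 - s) := by
  induction K with
  | zero => simp
  | succ K ih =>
    rw [Finset.sum_range_succ, ih, ← add_assoc, Finset.sum_range_succ, rightEndpointError, cpow_neg]
    push_cast
    ring

lemma riemannZeta_eq_sum_add_tsum_of_one_lt_re {s : ℂ} (hs : 1 < s.re) {N : ℕ} (hN : 1 ≤ N)
    (hsum : Summable fun k : ℕ => rightEndpointError s ((N + k : ℕ) : ℝ)) :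
    riemannZeta s = ∑ i ∈ Finset.range N, 1 / ((i : ℂ) + 1) ^ s + (N : ℂ) ^ (1 - s) / (s - 1) +
      ∑' k : ℕ, rightEndpointError s ((N + k : ℕ) : ℝ) := by
  have hs1 : s ≠ 1 := by rintro rfl; simp at hs
  have hz : Tendsto (fun K : ℕ => ∑ i ∈ Finset.range (N + K), 1 / ((i : ℂ) + 1) ^ s) atTop
      (𝓝 (riemannZeta s)) := by
    rw [zeta_eq_tsum_one_div_nat_add_one_cpow hs]
    have hS : Summable fun n : ℕ => 1 / ((n : ℂ) + 1) ^ s := by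
      have := (summable_nat_add_iff 1).mpr (Complex.summable_one_div_nat_cpow.mpr hs)
      simpa using this
    refine hS.hasSum.tendsto_sum_nat.comp ?_
    exact tendsto_atTop_mono (fun K => Nat.le_add_left K N) tendsto_id
  have hp : Tendsto (fun K : ℕ => ((N + K : ℕ) : ℂ) ^ (1 - s)) atTop (𝓝 0) := by
    rw [tendsto_zero_iff_norm_tendsto_zero]
    have h1 : Tendsto (fun K : ℕ => ((N + K : ℕ) : ℝ) ^ (-(s.re - 1))) atTop (𝓝 0) :=
      ((tendsto_rpow_neg_atTop (by linarith : 0 < s.re - 1)).comp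
        tendsto_natCast_atTop_atTop).comp
        (tendsto_atTop_mono (fun K => Nat.le_add_left K N) tendsto_id)
    refine h1.congr fun K => ?_
    rw [norm_natCast_cpow_of_pos (by omega)]
    simp
  have h2 := hsum.hasSum.tendsto_sum_nat
  simp_rw [sum_rightEndpointError] at h2
  have h3 := (hz.sub_const (∑ i ∈ Finset.range N, 1 / ((i : ℂ) + 1) ^ s)).sub
    ((hp.sub_const ((N : ℂ) ^ (1 - s))).div_const (1 - s))
  rw [tendsto_nhds_unique h2 h3]
  have : (1 : ℂ) - s ≠ 0 := sub_ne_zero.mpr hs1.symm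
  have : s - 1 ≠ 0 := sub_ne_zero.mpr hs1
  field_simp
  ring

lemma summable_rightEndpointError_bound {σ C : ℝ} (hσ : 0 < σ) {N : ℕ} :
    Summable fun k : ℕ => C * ((N + k : ℕ) : ℝ) ^ (-σ - 1) := by
  have h := Real.summable_nat_rpow.mpr (by linarith : -σ - 1 < -1)
  have h2 := (summable_nat_add_iff N).mpr h
  refine Summable.mul_left C (h2.congr fun k => ?_)
  rw [add_comm k N]

lemma norm_rightEndpointError_le' {x : ℝ} (hx : 1 ≤ x) {s : ℂ} {σ C : ℝ} (hσ : 0 < σ)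
    (hs : σ ≤ s.re) (hs1 : s ≠ 1) (hC : ‖s‖ ≤ C) :
    ‖rightEndpointError s x‖ ≤ C * x ^ (-σ - 1) := by
  have hx0 : 0 < x := by linarith
  have hs0 : 0 < s.re := by linarith
  refine (norm_rightEndpointError_le hx0 hs0 hs1).trans ?_
  calc ‖s‖ / s.re * (x ^ (-s.re) - (x + 1) ^ (-s.re))
      ≤ ‖s‖ / s.re * (s.re * x ^ (-s.re - 1)) := by
        gcongr; exact rpow_neg_sub_le hx0 hs0
    _ = ‖s‖ * x ^ (-s.re - 1) := by field_simp
    _ ≤ C * x ^ (-σ - 1) := by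
        have hC0 : 0 ≤ C := (norm_nonneg s).trans hC
        gcongr

/-- The Euler–Maclaurin formula of order zero for `ζ` in the first quadrant. -/
lemma riemannZeta_eq_sum_add_tsum {s : ℂ} (hs : 0 < s.re) (hs' : 0 < s.im) {N : ℕ} (hN : 1 ≤ N) :
    riemannZeta s = ∑ i ∈ Finset.range N, 1 / ((i : ℂ) + 1) ^ s + (N : ℂ) ^ (1 - s) / (s - 1) +
      ∑' k : ℕ, rightEndpointError s ((N + k : ℕ) : ℝ) := by
  -- The identity theorem runs on a convex set `U` containing `s` and a point with real part `2`.
  -- The condition `Im > 0` avoids the pole without losing convexity, the half-plane `Re > σ` and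
  -- the ball of radius `C` make the series uniformly summable. The `1` in the minimum and the `3`
  -- in `C` keep `2 + i Im s` inside.
  set σ := min (s.re / 2) 1 with hσ
  have hσ0 : 0 < σ := by positivity
  set C := ‖s‖ + 3
  set U : Set ℂ := {z | σ < z.re} ∩ {z | 0 < z.im} ∩ Metric.ball 0 C with hU
  have hUo : IsOpen U := ((isOpen_lt continuous_const continuous_re).inter
    (isOpen_lt continuous_const continuous_im)).inter Metric.isOpen_ball
  have hUc : Convex ℝ U := ((convex_halfSpace_re_gt σ).inter (convex_halfSpace_im_gt 0)).inter
    (convex_ball 0 C)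
  have hne : ∀ z ∈ U, z ≠ 1 := by
    rintro z ⟨⟨-, h⟩, -⟩ rfl
    simp at h
  have hb : ∀ k : ℕ, ∀ z ∈ U, ‖rightEndpointError z ((N + k : ℕ) : ℝ)‖ ≤
      C * ((N + k : ℕ) : ℝ) ^ (-σ - 1) := by
    intro k z hz
    refine norm_rightEndpointError_le' (by exact_mod_cast (by omega : 1 ≤ N + k)) hσ0
      hz.1.1.le (hne z hz) ?_
    have := hz.2
    rw [mem_ball_zero_iff] at this
    exact this.le
  have hnat : ∀ k : ℕ, ((N + k : ℕ) : ℂ) ≠ 0 := fun k => by exact_mod_cast (by omega : N + k ≠ 0)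
  have hnat' : ∀ k : ℕ, ((k : ℂ) + 1) ≠ 0 := fun k => by exact_mod_cast (by omega : k + 1 ≠ 0)
  have hd : DifferentiableOn ℂ (fun z => ∑' k : ℕ, rightEndpointError z ((N + k : ℕ) : ℝ)) U := by
    refine differentiableOn_tsum_of_summable_norm
      (summable_rightEndpointError_bound (C := C) hσ0) (fun k z hz => ?_) hUo hb
    refine DifferentiableAt.differentiableWithinAt ?_
    have h1 : (1 : ℂ) - z ≠ 0 := sub_ne_zero.mpr (hne z hz).symm
    have h2 := hnat k
    have h3 := hnat' (N + k)
    push_cast at h2 h3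
    unfold rightEndpointError
    push_cast
    refine ((differentiableAt_id.neg).const_cpow (Or.inl h3)).sub (DifferentiableAt.div
      (((differentiableAt_const _).sub differentiableAt_id).const_cpow (Or.inl h3) |>.sub
      (((differentiableAt_const _).sub differentiableAt_id).const_cpow (Or.inl h2)))
      (by fun_prop) h1)
  have hd2 : DifferentiableOn ℂ (fun z => ∑ i ∈ Finset.range N, 1 / ((i : ℂ) + 1) ^ z +
      (N : ℂ) ^ (1 - z) / (z - 1) + ∑' k : ℕ, rightEndpointError z ((N + k : ℕ) : ℝ)) U := by
    refine DifferentiableOn.add (fun z hz => DifferentiableAt.differentiableWithinAt ?_) hd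
    have h1 : z - 1 ≠ 0 := sub_ne_zero.mpr (hne z hz)
    refine DifferentiableAt.add (DifferentiableAt.fun_sum fun i _ => ?_) (DifferentiableAt.div
      (((differentiableAt_const _).sub differentiableAt_id).const_cpow (Or.inl (by simpa using hnat 0)))
      (by fun_prop) h1)
    refine DifferentiableAt.div (by fun_prop) (differentiableAt_id.const_cpow (Or.inl (hnat' i))) ?_
    simp [cpow_eq_zero_iff, hnat' i]
  have hz : DifferentiableOn ℂ riemannZeta U := fun z hz =>
    (differentiableAt_riemannZeta (hne z hz)).differentiableWithinAt
  have hre : σ < s.re := (min_le_left _ _).trans_lt (by linarith)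
  have him : s.im ≤ ‖s‖ := (le_abs_self _).trans (abs_im_le_norm s)
  have hsU : s ∈ U := ⟨⟨hre, hs'⟩, by rw [mem_ball_zero_iff]; simp only [C]; linarith⟩
  set z₀ : ℂ := 2 + s.im * I with hz₀
  have hz₀U : z₀ ∈ U := by
    refine ⟨⟨?_, ?_⟩, ?_⟩
    · have : σ ≤ 1 := min_le_right _ _
      simp [hz₀]; linarith
    · simpa [hz₀] using hs'
    · rw [mem_ball_zero_iff]
      calc ‖z₀‖ ≤ ‖(2 : ℂ)‖ + ‖(s.im : ℂ) * I‖ := norm_add_le _ _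
        _ = 2 + s.im := by simp [abs_of_pos hs']
        _ < C := by simp only [C]; linarith
  have hev : riemannZeta =ᶠ[𝓝 z₀] fun z => ∑ i ∈ Finset.range N, 1 / ((i : ℂ) + 1) ^ z +
      (N : ℂ) ^ (1 - z) / (z - 1) + ∑' k : ℕ, rightEndpointError z ((N + k : ℕ) : ℝ) := by
    have h1 : ∀ᶠ z in 𝓝 z₀, 1 < z.re :=
      (isOpen_lt continuous_const continuous_re).mem_nhds (by simp [hz₀])
    filter_upwards [h1, hUo.mem_nhds hz₀U] with z hz1 hz2
    refine riemannZeta_eq_sum_add_tsum_of_one_lt_re hz1 hN ?_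
    exact Summable.of_norm_bounded (summable_rightEndpointError_bound (C := C) hσ0)
      fun k => hb k z hz2
  exact (hz.analyticOnNhd hUo).eqOn_of_preconnected_of_eventuallyEq (hd2.analyticOnNhd hUo)
    hUc.isPreconnected hz₀U hev hsU

lemma norm_tsum_rightEndpointError_le {s : ℂ} (hs : 0 < s.re) (hs1 : s ≠ 1) {N : ℕ} (hN : 1 ≤ N) :
    ‖∑' k : ℕ, rightEndpointError s ((N + k : ℕ) : ℝ)‖ ≤ ‖s‖ / s.re * (N : ℝ) ^ (-s.re) := by
  refine tsum_of_norm_bounded (g := fun k : ℕ => ‖s‖ / s.re *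
    (((N + k : ℕ) : ℝ) ^ (-s.re) - ((N + (k + 1) : ℕ) : ℝ) ^ (-s.re))) ?_ fun k => ?_
  · refine HasSum.mul_left _ ?_
    have h0 : ∀ k : ℕ, 0 ≤ ((N + k : ℕ) : ℝ) ^ (-s.re) - ((N + (k + 1) : ℕ) : ℝ) ^ (-s.re) := by
      intro k
      rw [sub_nonneg]
      refine Real.rpow_le_rpow_of_nonpos ?_ ?_ (by linarith)
      · exact_mod_cast (by omega : 0 < N + k)
      · exact_mod_cast (by omega)
    rw [hasSum_iff_tendsto_nat_of_nonneg h0]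
    have h1 : Tendsto (fun K : ℕ => ((N + K : ℕ) : ℝ) ^ (-s.re)) atTop (𝓝 0) :=
      ((tendsto_rpow_neg_atTop hs).comp tendsto_natCast_atTop_atTop).comp
        (tendsto_atTop_mono (fun K => Nat.le_add_left K N) tendsto_id)
    have h2 := h1.const_sub ((N : ℝ) ^ (-s.re))
    rw [sub_zero] at h2
    refine h2.congr fun K => ?_
    rw [Finset.sum_range_sub' (fun k : ℕ => ((N + k : ℕ) : ℝ) ^ (-s.re))]
    simp
  · have := norm_rightEndpointError_le (x := ((N + k : ℕ) : ℝ))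
      (by exact_mod_cast (by omega : 0 < N + k)) hs hs1
    refine this.trans (le_of_eq ?_)
    push_cast
    ring_nf

/-- Each term has norm `n ^ (1 - σ) / n`, whose numerator is at most `N ^ max(0, 1 - σ)`; the
harmonic sum gives the logarithm. -/
lemma norm_sum_one_div_cpow_le (s : ℂ) (N : ℕ) :
    ‖∑ i ∈ Finset.range N, 1 / ((i : ℂ) + 1) ^ s‖ ≤
      (N : ℝ) ^ (max 0 (1 - s.re)) * (1 + Real.log N) := by
  have h1 : ∀ i ∈ Finset.range N, ‖1 / ((i : ℂ) + 1) ^ s‖ ≤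
      (N : ℝ) ^ (max 0 (1 - s.re)) * ((i : ℝ) + 1)⁻¹ := by
    intro i hi
    have hi' : ((i : ℝ) + 1) ≤ N := by exact_mod_cast Finset.mem_range.mp hi
    have hp : (0 : ℝ) < (i : ℝ) + 1 := by positivity
    have e : ((i : ℂ) + 1) = (((i : ℝ) + 1 : ℝ) : ℂ) := by push_cast; rfl
    rw [norm_div, norm_one, e, norm_cpow_eq_rpow_re_of_pos hp]
    calc 1 / ((i : ℝ) + 1) ^ s.re = ((i : ℝ) + 1) ^ (1 - s.re) * ((i : ℝ) + 1)⁻¹ := by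
          rw [Real.rpow_sub hp, Real.rpow_one]; field_simp
      _ ≤ ((i : ℝ) + 1) ^ (max 0 (1 - s.re)) * ((i : ℝ) + 1)⁻¹ := by
          gcongr
          · linarith [(Nat.cast_nonneg i : (0 : ℝ) ≤ i)]
          · exact le_max_right _ _
      _ ≤ _ := by gcongr
  refine (norm_sum_le_of_le _ h1).trans ?_
  rw [← Finset.mul_sum]
  gcongr
  refine le_trans (le_of_eq ?_) (harmonic_le_one_add_log N)
  simp [harmonic]

/-- A bound of convexity type for `ζ` to the right of the critical line. -/
lemma norm_riemannZeta_le {s : ℂ} (hs : 1 / 2 ≤ s.re) (ht : 1000 ≤ s.im) :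
    ‖riemannZeta s‖ ≤ s.im ^ (max 0 (1 - s.re)) * (Real.log s.im + 3.1) := by
  set t := s.im with ht'
  set M := max 0 (1 - s.re) with hM
  have hM0 : 0 ≤ M := le_max_left _ _
  have ht0 : 0 < t := by linarith
  have hσ : 0 < s.re := by linarith
  have hs1 : s ≠ 1 := by rintro rfl; simp at ht'; linarith
  -- Cutting at `N ≈ t` makes the partial sum, the pole term and the remainder at most `1 + log t`,
  -- `0.001` and `2.05` times `t ^ M`; the constants add up to `3.051`.
  set N := ⌊t⌋₊ with hN
  have hNt : (N : ℝ) ≤ t := Nat.floor_le ht0.le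
  have htN : t < N + 1 := Nat.lt_floor_add_one t
  have hN1 : (999 : ℝ) < N := by linarith
  have hN0 : (0 : ℝ) < N := by linarith
  have hN1' : 1 ≤ N := by
    have : (1 : ℝ) ≤ N := by linarith
    exact_mod_cast this
  rw [riemannZeta_eq_sum_add_tsum hσ ht0 hN1']
  have hNM : (N : ℝ) ^ (1 - s.re) ≤ t ^ M := by
    calc (N : ℝ) ^ (1 - s.re) ≤ (N : ℝ) ^ M := by
          gcongr
          · linarith
          · exact le_max_right _ _
      _ ≤ t ^ M := by gcongr
  have hns : ‖s‖ ≤ s.re + t := by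
    refine (norm_le_abs_re_add_abs_im s).trans ?_
    rw [abs_of_pos hσ, ← ht', abs_of_pos ht0]
  have b1 : ‖∑ i ∈ Finset.range N, 1 / ((i : ℂ) + 1) ^ s‖ ≤ t ^ M * (1 + Real.log t) := by
    refine (norm_sum_one_div_cpow_le s N).trans ?_
    have : 0 ≤ Real.log N := Real.log_nonneg (by linarith)
    gcongr
  have b2 : ‖(N : ℂ) ^ (1 - s) / (s - 1)‖ ≤ t ^ M * 0.001 := by
    rw [norm_div, norm_natCast_cpow_of_pos (by omega), sub_re, one_re]
    have h1 : t ≤ ‖s - 1‖ := by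
      have := abs_im_le_norm (s - 1)
      simp only [sub_im, one_im, sub_zero] at this
      exact (le_abs_self _).trans this
    rw [div_le_iff₀ (by linarith)]
    calc (N : ℝ) ^ (1 - s.re) ≤ t ^ M * 1 := by simpa using hNM
      _ ≤ t ^ M * (0.001 * ‖s - 1‖) := by gcongr; linarith
      _ = _ := by ring
  have b3 : ‖∑' k : ℕ, rightEndpointError s ((N + k : ℕ) : ℝ)‖ ≤ t ^ M * 2.05 := by
    refine (norm_tsum_rightEndpointError_le hσ hs1 hN1').trans ?_
    have e : (N : ℝ) ^ (-s.re) = (N : ℝ) ^ (1 - s.re) / N := by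
      rw [show (-s.re) = (1 - s.re) - 1 by ring, Real.rpow_sub hN0 (1 - s.re) 1, Real.rpow_one]
    have h1 : ‖s‖ / s.re ≤ 1 + 2 * t := by
      rw [div_le_iff₀ hσ]
      nlinarith
    calc ‖s‖ / s.re * (N : ℝ) ^ (-s.re) ≤ (1 + 2 * t) * (t ^ M / N) := by
          rw [e]; gcongr
      _ = t ^ M * ((1 + 2 * t) / N) := by ring
      _ ≤ _ := by
          gcongr
          rw [div_le_iff₀ hN0]
          linarith
  calc _ ≤ t ^ M * (1 + Real.log t) + t ^ M * 0.001 + t ^ M * 2.05 :=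
        (norm_add₃_le).trans (by gcongr)
    _ = t ^ M * (Real.log t + 3.051) := by ring
    _ ≤ _ := by gcongr; norm_num


/-! ### A holomorphic logarithm of `ζ` -/

lemma riemannZeta_ofReal_re_le {σ : ℝ} (hσ : 1 < σ) :
    (riemannZeta σ).re ≤ 1 + 1 / (σ - 1) := by
  have h1 := ZetaAsymptotics.zeta_limit_aux1 hσ
  have h2 : riemannZeta σ = ((∑' n : ℕ, 1 / (n + 1 : ℝ) ^ σ : ℝ) : ℂ) := by
    rw [zeta_eq_tsum_one_div_nat_add_one_cpow (by simpa using hσ), ofReal_tsum]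
    refine tsum_congr fun n => ?_
    have : (0 : ℝ) ≤ (n : ℝ) + 1 := by positivity
    push_cast [ofReal_cpow this]
    rfl
  have h3 : 0 ≤ ZetaAsymptotics.termTSum σ :=
    tsum_nonneg fun n => ZetaAsymptotics.term_nonneg (n + 1) σ
  rw [h2, ofReal_re]
  nlinarith

/-- The coefficients `Λ(n) / log n` of the Dirichlet series of `log ζ`. -/
noncomputable def logZetaCoeff (n : ℕ) : ℂ := ArithmeticFunction.vonMangoldt n / Real.log n

lemma norm_logZetaCoeff_le (n : ℕ) : ‖logZetaCoeff n‖ ≤ 1 := by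
  rw [logZetaCoeff, norm_div, norm_real, norm_real,
    Real.norm_of_nonneg ArithmeticFunction.vonMangoldt_nonneg,
    Real.norm_of_nonneg (Real.log_natCast_nonneg n)]
  exact div_le_one_of_le₀ ArithmeticFunction.vonMangoldt_le_log (Real.log_natCast_nonneg n)

lemma LSeriesSummable_logZetaCoeff {s : ℂ} (hs : 1 < s.re) : LSeriesSummable logZetaCoeff s :=
  LSeriesSummable_of_bounded_of_one_lt_re (m := 1) (fun n _ => norm_logZetaCoeff_le n) hs

lemma differentiableAt_LSeries_logZetaCoeff {s : ℂ} (hs : 1 < s.re) :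
    DifferentiableAt ℂ (LSeries logZetaCoeff) s := by
  refine (LSeries_hasDerivAt ?_).differentiableAt
  refine lt_of_le_of_lt (b := ((1 : ℝ) : EReal))
    (LSeries.abscissaOfAbsConv_le_of_forall_lt_LSeriesSummable fun y hy => ?_) (by exact_mod_cast hs)
  exact LSeriesSummable_logZetaCoeff (by simpa using hy)

/-- The coefficients are nonnegative, so the series of norms at `s` is the series itself at `Re s`.
-/
lemma norm_LSeries_logZetaCoeff_le {s : ℂ} (hs : 1 < s.re) :
    ‖LSeries logZetaCoeff s‖ ≤ Real.log (riemannZeta s.re).re := by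
  rw [log_riemannZeta_eq hs]
  have hsum := (LSeriesSummable_logZetaCoeff hs).norm
  refine (norm_tsum_le_tsum_norm hsum).trans (le_of_eq (tsum_congr fun n => ?_))
  rw [LSeries.norm_term_eq]
  split_ifs with h
  · simp [h]
  · rw [logZetaCoeff, norm_div, norm_real, norm_real,
      Real.norm_of_nonneg ArithmeticFunction.vonMangoldt_nonneg,
      Real.norm_of_nonneg (Real.log_natCast_nonneg n), div_div, mul_comm]

lemma RiemannHypothesis.riemannZeta_ne_zero (hRH : RiemannHypothesis) {s : ℂ} (hs : 1 / 2 < s.re) :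
    riemannZeta s ≠ 0 := by
  intro h
  rcases eq_or_ne s 1 with rfl | h1
  · exact riemannZeta_one_ne_zero h
  · have := hRH s h (by
      rintro ⟨n, rfl⟩
      have : (-2 * ((n : ℂ) + 1)).re = -2 * ((n : ℝ) + 1) := by simp
      rw [this] at hs
      linarith [(Nat.cast_nonneg n : (0 : ℝ) ≤ n)]) h1
    linarith

/-- A continuous logarithm of a holomorphic function is holomorphic. -/
lemma differentiableAt_of_exp_eq {f g : ℂ → ℂ} {z : ℂ} (hf : ContinuousAt f z)
    (hg : DifferentiableAt ℂ g z) (hfg : ∀ᶠ w in 𝓝 z, exp (f w) = g w) :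
    DifferentiableAt ℂ f z := by
  have hz : exp (f z) = g z := hfg.self_of_nhds
  have hz0 : g z ≠ 0 := hz ▸ exp_ne_zero _
  -- Within distance `π` the principal logarithm inverts `exp`, so `f` agrees near `z` with `f z +
  -- log (g w / g z)`.
  have h1 : ∀ᶠ w in 𝓝 z, ‖f w - f z‖ < Real.pi := by
    have : Tendsto (fun w => ‖f w - f z‖) (𝓝 z) (𝓝 0) := by
      simpa using (hf.tendsto.sub_const (f z)).norm
    exact this.eventually_lt_const Real.pi_pos
  have h2 : DifferentiableAt ℂ (fun w => f z + log (g w / g z)) z := by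
    refine (DifferentiableAt.clog (hg.div_const _) ?_).const_add _
    rw [div_self hz0]
    exact one_mem_slitPlane
  refine h2.congr_of_eventuallyEq ?_
  filter_upwards [h1, hfg] with w hw hw2
  have him := (abs_im_le_norm (f w - f z)).trans_lt hw
  rw [← hw2, ← hz, ← exp_sub, log_exp (abs_lt.mp him).1 (abs_lt.mp him).2.le]
  ring

/-- The quadrant on which a logarithm of `ζ` is taken. -/
def logZetaDomain : Set ℂ := {s | 1 / 2 < s.re} ∩ {s | 0 < s.im}

lemma isOpen_logZetaDomain : IsOpen logZetaDomain :=
  (isOpen_lt continuous_const continuous_re).inter (isOpen_lt continuous_const continuous_im)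

/-- Under the Riemann hypothesis, `ζ` has a holomorphic logarithm for `Re s > 1/2`, `Im s > 0`
which agrees with its Dirichlet series for `Re s > 1`. -/
theorem RiemannHypothesis.exists_log_riemannZeta (hRH : RiemannHypothesis) :
    ∃ f : ℂ → ℂ, DifferentiableOn ℂ f logZetaDomain ∧
      (∀ s ∈ logZetaDomain, exp (f s) = riemannZeta s) ∧
      ∀ s : ℂ, 1 < s.re → 0 < s.im → ‖f s‖ ≤ Real.log (riemannZeta s.re).re := by
  have hconv : Convex ℝ logZetaDomain := (convex_halfSpace_re_gt _).inter (convex_halfSpace_im_gt 0)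
  have hne : logZetaDomain.Nonempty := ⟨1 + I, by constructor <;> norm_num⟩
  have hsc : IsSimplyConnected logZetaDomain := by
    have := hconv.contractibleSpace hne
    exact SimplyConnectedSpace.ofContractible _
  have hne1 : ∀ s ∈ logZetaDomain, s ≠ 1 := by
    rintro s ⟨-, h⟩ rfl
    simp at h
  have hζd : ∀ s ∈ logZetaDomain, DifferentiableAt ℂ riemannZeta s := fun s hs =>
    differentiableAt_riemannZeta (hne1 s hs)
  obtain ⟨f, hf, hfe⟩ := Complex.exists_continuousOn_eqOn_exp_comp hsc isOpen_logZetaDomain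
    (g := riemannZeta) (fun s hs => (hζd s hs).continuousAt.continuousWithinAt) (by
      rintro ⟨s, hs, h⟩
      exact hRH.riemannZeta_ne_zero hs.1 h)
  have hfe' : ∀ s ∈ logZetaDomain, exp (f s) = riemannZeta s := hfe
  have hfd : ∀ s ∈ logZetaDomain, DifferentiableAt ℂ f s := fun s hs =>
    differentiableAt_of_exp_eq (hf.continuousAt (isOpen_logZetaDomain.mem_nhds hs)) (hζd s hs)
      (by filter_upwards [isOpen_logZetaDomain.mem_nhds hs] with w hw using hfe' w hw)
  set V : Set ℂ := {s | 1 < s.re} ∩ {s | 0 < s.im} with hV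
  have hVo : IsOpen V :=
    (isOpen_lt continuous_const continuous_re).inter (isOpen_lt continuous_const continuous_im)
  have hVc : Convex ℝ V := (convex_halfSpace_re_gt _).inter (convex_halfSpace_im_gt 0)
  have hVsub : V ⊆ logZetaDomain := fun s hs =>
    ⟨lt_trans (by norm_num) (show 1 < s.re from hs.1), hs.2⟩
  have hdiff : DifferentiableOn ℂ (fun s => f s - LSeries logZetaCoeff s) V := fun s hs =>
    ((hfd s (hVsub hs)).sub
      (differentiableAt_LSeries_logZetaCoeff hs.1)).differentiableWithinAt
  -- On `Re s > 1` both functions are logarithms of `ζ`, so the exponential of their difference is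
  -- `1` and the difference is a constant `c` with `exp c = 1`. Subtracting `c` from `f` keeps it a
  -- logarithm.
  have hder : EqOn (deriv fun s => f s - LSeries logZetaCoeff s) 0 V := by
    intro s hs
    have hd := (hfd s (hVsub hs)).sub (differentiableAt_LSeries_logZetaCoeff hs.1)
    have h1 : (fun s => exp (f s - LSeries logZetaCoeff s)) =ᶠ[𝓝 s] fun _ => (1 : ℂ) := by
      filter_upwards [hVo.mem_nhds hs] with w hw
      have e : exp (LSeries logZetaCoeff w) = riemannZeta w := riemannZeta_eq_exp_LSeries hw.1
      rw [exp_sub, hfe' w (hVsub hw), e, div_self (hRH.riemannZeta_ne_zero (hVsub hw).1)]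
    have h2 := h1.deriv_eq
    have h3 := hd.hasDerivAt.cexp.deriv
    simp only [deriv_const] at h2
    rw [show (fun s => exp (f s - LSeries logZetaCoeff s)) =
      fun x => exp ((f - LSeries logZetaCoeff) x) from rfl, h3] at h2
    exact (mul_eq_zero.mp h2).resolve_left (exp_ne_zero _)
  set p : ℂ := 2 + I with hp
  have hpV : p ∈ V := by constructor <;> simp [hp]
  set c := f p - LSeries logZetaCoeff p with hc
  have hconst : ∀ s ∈ V, f s - c = LSeries logZetaCoeff s := fun s hs => by
    have := hVo.is_const_of_deriv_eq_zero hVc.isPreconnected hdiff hder hs hpV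
    rw [hc, ← this]
    ring
  have hcexp : exp c = 1 := by
    have e : exp (LSeries logZetaCoeff p) = riemannZeta p := riemannZeta_eq_exp_LSeries hpV.1
    rw [hc, exp_sub, hfe' p (hVsub hpV), e, div_self (hRH.riemannZeta_ne_zero (hVsub hpV).1)]
  refine ⟨fun s => f s - c, fun s hs => ((hfd s hs).sub_const c).differentiableWithinAt,
    fun s hs => by rw [exp_sub, hfe' s hs, hcexp, div_one], fun s h1 h2 => ?_⟩
  simp only
  rw [hconst s ⟨h1, h2⟩]
  exact norm_LSeries_logZetaCoeff_le h1


/-! ### A Borel–Carathéodory bound for `log ζ` -/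

/-- A harmonic majorant, whose nonconstant part can be subtracted before Borel–Carathéodory. With `u
= z / R` and `x = Re u ≥ -1`, the left side is at most `max(0, -x/2)`. Using `(Im u)² ≤ 1 - x²`, the
differences from `0` and `-x/2` are at least `(x - 3/4)²/6` and `(x + 3/4)²/6`; completing these
squares is what fixes `17/96`. It matters that `17/96 < 1/4`: the pointwise maximum `1/2` would be
too large for `K`. -/
lemma max_zero_one_sub_re_le {η : ℝ} (hη : 0 < η) {z : ℂ} (hz : ‖z‖ < 1 / 2 + η) :
    max 0 (-(η + z.re)) ≤ 17 / 96 +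
      (-(z / ((1 / 2 + η : ℝ) : ℂ)) / 4 + (z / ((1 / 2 + η : ℝ) : ℂ)) ^ 2 / 12).re := by
  set R : ℝ := 1 / 2 + η with hR
  have hR0 : 0 < R := by positivity
  set u : ℂ := z / (R : ℂ) with hu
  have hzu : z = R * u := by
    have hRc : (R : ℂ) ≠ 0 := by exact_mod_cast hR0.ne'
    rw [hu, mul_div_cancel₀ _ hRc]
  have hu1 : ‖u‖ < 1 := by
    rw [hu, norm_div, norm_real, Real.norm_of_nonneg hR0.le, div_lt_one hR0]; exact hz
  have hsq : u.re ^ 2 + u.im ^ 2 ≤ 1 := by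
    have := Complex.sq_norm u
    rw [normSq_apply] at this
    nlinarith [norm_nonneg u]
  have hre : z.re = R * u.re := by rw [hzu]; simp
  have e : (-u / 4 + u ^ 2 / 12).re = -u.re / 4 + (u.re ^ 2 - u.im ^ 2) / 12 := by
    rw [show -u / 4 + u ^ 2 / 12 = ((1 / 4 : ℝ) : ℂ) * (-u) + ((1 / 12 : ℝ) : ℂ) * (u * u) by
      push_cast; ring]
    rw [add_re, re_ofReal_mul, re_ofReal_mul, neg_re, mul_re]
    ring
  rw [e, hre]
  have habs : -1 ≤ u.re := by nlinarith [sq_nonneg u.im]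
  refine max_le ?_ ?_
  · nlinarith [sq_nonneg (u.re - 3 / 4)]
  · have : -(η + R * u.re) ≤ -u.re / 2 := by rw [hR]; nlinarith
    nlinarith [sq_nonneg (u.re + 3 / 4)]

/-- A variant of the Borel–Carathéodory theorem in which the real part is bounded by a multiple of
`max 0 (1 - Re w)` instead of a constant. -/
lemma norm_le_of_re_le_max {f : ℂ → ℂ} {η t Λ P Z : ℝ} (hη : 0 < η) (hΛ : 0 ≤ Λ) (hP : 0 < P)
    (hf : DifferentiableOn ℂ f (Metric.ball (1 + η + t * I) (1 / 2 + η)))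
    (hre : ∀ w ∈ Metric.ball (1 + η + t * I : ℂ) (1 / 2 + η), (f w).re ≤ max 0 (1 - w.re) * Λ + P)
    (hZ : ‖f (1 + η + t * I)‖ ≤ Z) {r : ℝ} (hr : 0 ≤ r) (hrR : r < 1 / 2 + η) :
    ‖f (1 + η - r + t * I)‖ ≤
      Z + Λ / 3 + 2 * (P + 17 / 96 * Λ + Z) * r / (1 / 2 + η - r) := by
  set R : ℝ := 1 / 2 + η with hR
  have hR0 : 0 < R := by positivity
  have hZ0 : 0 ≤ Z := (norm_nonneg _).trans hZ
  set w₀ : ℂ := 1 + η + t * I with hw₀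
  set H : ℂ → ℂ := fun z => -(z / (R : ℂ)) / 4 + (z / (R : ℂ)) ^ 2 / 12 with hH
  -- After this correction `g 0 = 0` and `Re g` is bounded by a constant; undoing it costs `Z` and
  -- `Λ |H(-r)| ≤ Λ (1/4 + 1/12)`.
  set g : ℂ → ℂ := fun z => f (w₀ + z) - f w₀ - Λ * H z with hg
  have hball : ∀ z ∈ Metric.ball (0 : ℂ) R, w₀ + z ∈ Metric.ball w₀ R := by
    intro z hz
    rw [mem_ball_iff_norm, add_sub_cancel_left]
    exact mem_ball_zero_iff.mp hz
  have hgd : DifferentiableOn ℂ g (Metric.ball 0 R) := by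
    have h1 : DifferentiableOn ℂ (fun z => f (w₀ + z)) (Metric.ball 0 R) :=
      hf.comp (by fun_prop) hball
    have h2 : Differentiable ℂ H := by
      rw [hH]; fun_prop
    exact (h1.sub_const _).sub (h2.differentiableOn.const_mul _)
  have hmaps : MapsTo g (Metric.ball 0 R) {z | z.re ≤ P + 17 / 96 * Λ + Z} := by
    intro z hz
    have h1 := hre _ (hball z hz)
    have h2 := max_zero_one_sub_re_le hη (mem_ball_zero_iff.mp hz)
    have e1 : (1 - (w₀ + z).re) = -(η + z.re) := by simp [hw₀]; ring
    rw [e1] at h1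
    have h3 : -(f w₀).re ≤ Z := by
      have := (abs_re_le_norm (f w₀)).trans hZ
      linarith [neg_abs_le (f w₀).re]
    have h4 := mul_le_mul_of_nonneg_right h2 hΛ
    simp only [hg, mem_ofPred_eq, sub_re, re_ofReal_mul]
    have e2 : (H z).re = (-(z / ((1 / 2 + η : ℝ) : ℂ)) / 4 +
      (z / ((1 / 2 + η : ℝ) : ℂ)) ^ 2 / 12).re := rfl
    rw [e2]
    linarith
  have hz : (-r : ℂ) ∈ Metric.ball (0 : ℂ) R := by
    rw [mem_ball_zero_iff, norm_neg, norm_real, Real.norm_of_nonneg hr]; exact hrR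
  have hg0 : g 0 = 0 := by simp [hg, hH]
  have hBC := borelCaratheodory_zero (M := P + 17 / 96 * Λ + Z) (by positivity) hgd hmaps hR0 hz hg0
  rw [norm_neg, norm_real, Real.norm_of_nonneg hr] at hBC
  have hHn : ‖H (-r)‖ ≤ 1 / 3 := by
    have hu : ‖(-r : ℂ) / (R : ℂ)‖ ≤ 1 := by
      rw [norm_div, norm_neg, norm_real, norm_real, Real.norm_of_nonneg hr,
        Real.norm_of_nonneg hR0.le, div_le_one hR0]
      exact hrR.le
    refine (norm_add_le _ _).trans ?_
    rw [norm_div, norm_div, norm_neg, norm_pow]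
    norm_num
    norm_num at hu
    nlinarith [norm_nonneg ((r : ℂ)), abs_nonneg r, div_nonneg (abs_nonneg r) (abs_nonneg R)]
  have e : f (1 + η - r + t * I) = g (-r) + f w₀ + Λ * H (-r) := by
    simp only [hg]
    rw [show w₀ + -(r : ℂ) = 1 + η - r + t * I by rw [hw₀]; ring]
    ring
  rw [e]
  calc ‖g (-r) + f w₀ + Λ * H (-r)‖ ≤ ‖g (-r)‖ + ‖f w₀‖ + ‖(Λ : ℂ) * H (-r)‖ := norm_add₃_le
    _ ≤ 2 * (P + 17 / 96 * Λ + Z) * r / (R - r) + Z + Λ * (1 / 3) := by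
        rw [norm_mul, norm_real, Real.norm_of_nonneg hΛ]
        gcongr
    _ = _ := by ring

lemma exp_two_gt : (7.38 : ℝ) < Real.exp 2 := by
  have h := Real.exp_one_gt_d9
  rw [show (2 : ℝ) = 1 + 1 by norm_num, Real.exp_add]
  nlinarith

lemma exp_exp_two_gt : (1001 : ℝ) < Real.exp (Real.exp 2) := by
  have h1 : Real.exp 7 < Real.exp (Real.exp 2) :=
    Real.exp_lt_exp.mpr (by linarith [exp_two_gt])
  have h2 : Real.exp 7 = Real.exp 1 ^ 7 := by
    rw [← Real.exp_nat_mul]; norm_num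
  have h3 : (2.7 : ℝ) ^ 7 ≤ Real.exp 1 ^ 7 := by
    gcongr
    linarith [Real.exp_one_gt_d9]
  norm_num at h3
  linarith

/-- The slack `(1/4 - 17/96) Λ = 7Λ/96` is about `0.538` at `Λ = 7.38`. It absorbs the `0.36` lost
in `log(Λ + 3.1)` and the excess of `log(1 + η)` over `γη`, estimated by the tangent of `log` at
`3/2` and by `γ > 1/2`. -/
lemma log_add_log_le {Λ η : ℝ} (hΛ : Real.exp 2 ≤ Λ) (hη : 0 < η) (hη' : η ≤ 1 / 2) :
    Real.log (Λ + 3.1) + 17 / 96 * Λ + Real.log (1 + 1 / η) ≤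
      Λ / 4 + Real.log Λ + (Real.log (1 / η) + Real.eulerMascheroniConstant * η) := by
  have hΛ' : 7.38 < Λ := exp_two_gt.trans_le hΛ
  have h1 : Real.log (Λ + 3.1) ≤ Real.log Λ + 0.36 := by
    rw [← sub_le_iff_le_add', ← Real.log_div (by positivity) (by positivity),
      Real.log_le_iff_le_exp (by positivity)]
    have := Real.quadratic_le_exp_of_nonneg (show (0 : ℝ) ≤ 0.36 by norm_num)
    refine le_trans ?_ this
    rw [div_le_iff₀ (by positivity)]
    linarith
  have h2 : Real.log (1 + 1 / η) = Real.log (1 / η) + Real.log (1 + η) := by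
    rw [← Real.log_mul (by positivity) (by positivity)]
    congr 1
    field_simp
    ring
  have h3 : Real.log (1 + η) ≤ 0.42 + 2 / 3 * η - 1 / 3 := by
    have h4 : Real.log (3 / 2) ≤ 0.42 := by
      rw [Real.log_le_iff_le_exp (by positivity)]
      have := Real.quadratic_le_exp_of_nonneg (show (0 : ℝ) ≤ 0.42 by norm_num)
      exact le_trans (by norm_num) this
    have h5 : Real.log ((1 + η) / (3 / 2)) ≤ (1 + η) / (3 / 2) - 1 :=
      Real.log_le_sub_one_of_pos (by positivity)
    rw [Real.log_div (by positivity) (by positivity)] at h5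
    linarith
  have h6 := Real.one_half_lt_eulerMascheroniConstant
  nlinarith

lemma convexityK_zeta (C₁ t : ℝ) :
    convexityK 1 1 1 1 C₁ t = (1 + 2 * (C₁ / Real.log (Real.log t))) * (1 / 4 +
      Real.log (Real.log t) / Real.log t + (Real.log (Real.log (Real.log t)) + Real.log (1 / C₁) +
            Real.eulerMascheroniConstant * (C₁ / Real.log (Real.log t))) / Real.log t) := by
  unfold convexityK
  rw [Real.posLog_one]
  ring

/-- `K` is formed at the fixed height `T₂` but must serve all larger heights: `log Λ / Λ` decreases
for `Λ ≥ e`, and the remaining nonnegative terms are constant in `Λ`. -/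
lemma le_convexityK_mul {C₁ T₂ Λ : ℝ} (hC₁ : 0 < C₁) (hC₁' : C₁ ≤ 1)
    (hT₂ : Real.exp (Real.exp 2) ≤ T₂) (hΛ : Real.log T₂ ≤ Λ) :
    (1 + 2 * (C₁ / Real.log (Real.log T₂))) * (Real.log (Λ + 3.1) + 17 / 96 * Λ +
      Real.log (1 + 1 / (C₁ / Real.log (Real.log T₂)))) ≤ convexityK 1 1 1 1 C₁ T₂ * Λ := by
  have hT0 : 0 < T₂ := (Real.exp_pos _).trans_le hT₂
  set L := Real.log T₂ with hL
  have hL2 : Real.exp 2 ≤ L := (Real.le_log_iff_exp_le hT0).mpr hT₂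
  have hL0 : 0 < L := (Real.exp_pos _).trans_le hL2
  set l := Real.log L with hl
  have hl2 : 2 ≤ l := (Real.le_log_iff_exp_le hL0).mpr hL2
  set η := C₁ / l with hη
  have hη0 : 0 < η := by positivity
  have hη1 : η ≤ 1 / 2 := by
    rw [hη, div_le_iff₀ (by linarith)]; linarith
  have h1 := log_add_log_le (hL2.trans hΛ) hη0 hη1
  rw [convexityK_zeta, mul_assoc]
  gcongr
  refine h1.trans ?_
  have e1 : Real.log (1 / η) = Real.log l + Real.log (1 / C₁) := by
    rw [← Real.log_mul (by positivity) (by positivity), hη]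
    congr 1
    field_simp
  have hnn : 0 ≤ Real.log (1 / η) + Real.eulerMascheroniConstant * η := by
    have : 0 ≤ Real.log (1 / η) := Real.log_nonneg (by
      rw [le_div_iff₀ hη0]; linarith)
    have := Real.one_half_lt_eulerMascheroniConstant
    positivity
  have h2 : Real.log Λ ≤ l / L * Λ := by
    have hx : L ∈ Ici (Real.exp 1) := (Real.exp_le_exp.mpr (by norm_num)).trans hL2
    have := Real.log_div_self_antitoneOn hx (hx.trans hΛ) hΛ
    simp only at this
    rwa [div_le_iff₀ (hL0.trans_le hΛ)] at this
  have h3 : Real.log (1 / η) + Real.eulerMascheroniConstant * η ≤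
      (Real.log (1 / η) + Real.eulerMascheroniConstant * η) / L * Λ := by
    rw [div_mul_eq_mul_div, le_div_iff₀ hL0]
    gcongr
  rw [e1] at h1 h3 ⊢
  linarith

/-- `f` is a holomorphic logarithm of `ζ` on the quadrant `Re s > 1/2`, `Im s > 0` that is bounded
by `log ζ(Re s)` when `Re s > 1`. -/
structure IsLogZeta (f : ℂ → ℂ) : Prop where
  differentiableOn : DifferentiableOn ℂ f logZetaDomain
  exp_eq : ∀ s ∈ logZetaDomain, exp (f s) = riemannZeta s
  norm_le : ∀ s : ℂ, 1 < s.re → 0 < s.im → ‖f s‖ ≤ Real.log (riemannZeta s.re).re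

lemma IsLogZeta.norm_le_log {f : ℂ → ℂ} (hf : IsLogZeta f) {s : ℂ} {η : ℝ} (hη : 0 < η)
    (hs : 1 + η ≤ s.re) (hs' : 0 < s.im) : ‖f s‖ ≤ Real.log (1 + 1 / η) := by
  have h1 : 1 < s.re := by linarith
  refine (hf.norm_le s h1 hs').trans (Real.log_le_log (riemannZeta_re_pos_of_one_lt h1) ?_)
  refine (riemannZeta_ofReal_re_le h1).trans ?_
  gcongr
  linarith

lemma IsLogZeta.re_le {f : ℂ → ℂ} (hf : IsLogZeta f) {s : ℂ} {t : ℝ} (hs : 1 / 2 < s.re)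
    (hs' : 1000 ≤ s.im) (ht : s.im ≤ t) :
    (f s).re ≤ max 0 (1 - s.re) * Real.log t + Real.log (Real.log t + 3.1) := by
  have him : 0 < s.im := by linarith
  have h1 := hf.exp_eq s ⟨hs, him⟩
  have h2 : ‖riemannZeta s‖ = Real.exp (f s).re := by rw [← h1, norm_exp]
  have h3 := norm_riemannZeta_le hs.le hs'
  rw [h2] at h3
  have h0 : 0 ≤ max 0 (1 - s.re) := le_max_left _ _
  have hl : 0 ≤ Real.log s.im := Real.log_nonneg (by linarith)
  have h4 := Real.log_le_log (Real.exp_pos _) h3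
  rw [Real.log_exp, Real.log_mul (by positivity) (by positivity), Real.log_rpow him] at h4
  refine h4.trans ?_
  gcongr

/-- A bound for `log ζ` to the right of the critical line. -/
lemma IsLogZeta.norm_le_convexityK {f : ℂ → ℂ} (hf : IsLogZeta f) {C₁ T₂ δ : ℝ} (hC₁ : 0 < C₁)
    (hC₁' : C₁ ≤ 1) (hT₂ : Real.exp (Real.exp 2) ≤ T₂) (hδ : 0 < δ) (hδ' : δ ≤ 1 / 2) {s : ℂ}
    (hs : 1 / 2 + δ ≤ s.re) (hs' : T₂ ≤ s.im) :
    ‖f s‖ ≤ convexityK 1 1 1 1 C₁ T₂ * Real.log (s.im + 1) / δ := by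
  have hTbig : 1001 < T₂ := exp_exp_two_gt.trans_le hT₂
  have hT0 : 0 < T₂ := by linarith
  set t := s.im with ht
  set Λ := Real.log (t + 1) with hΛ
  have hΛ2 : Real.log T₂ ≤ Λ := Real.log_le_log hT0 (by linarith)
  have hmain := le_convexityK_mul hC₁ hC₁' hT₂ hΛ2
  have hL2 : Real.exp 2 ≤ Real.log T₂ := (Real.le_log_iff_exp_le hT0).mpr hT₂
  have hL0 : 0 < Real.log T₂ := (Real.exp_pos _).trans_le hL2
  have hl2 : 2 ≤ Real.log (Real.log T₂) := (Real.le_log_iff_exp_le hL0).mpr hL2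
  set η := C₁ / Real.log (Real.log T₂) with hη
  have hη0 : 0 < η := by positivity
  have hη1 : η ≤ 1 / 2 := by
    rw [hη, div_le_iff₀ (by linarith)]; linarith
  have hΛ0 : 0 < Λ := hL0.trans_le hΛ2
  set P := Real.log (Λ + 3.1) with hP
  have hP0 : 0 < P := Real.log_pos (by linarith)
  set Z := Real.log (1 + 1 / η) with hZ
  have hZ0 : 0 ≤ Z := Real.log_nonneg (by linarith [show 0 < 1 / η by positivity])
  rw [le_div_iff₀ hδ]
  refine le_trans ?_ hmain
  rcases le_or_gt (1 + η) s.re with h | h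
  · have h1 := hf.norm_le_log hη0 h (by rw [← ht]; linarith)
    rw [← hZ] at h1
    nlinarith [norm_nonneg (f s)]
  -- The disc is tangent to `Re w = 1/2`. Its radius is at most `1`, so `T₂ > 1001` leaves imaginary
  -- parts at least `1000`, as the bound for `ζ` requires.
  · have hb : ∀ w ∈ Metric.ball (1 + η + t * I : ℂ) (1 / 2 + η),
        1 / 2 < w.re ∧ 1000 ≤ w.im ∧ w.im ≤ t + 1 := by
      intro w hw
      rw [mem_ball_iff_norm] at hw
      have h1 := abs_lt.mp ((abs_re_le_norm _).trans_lt hw)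
      have h2 := abs_lt.mp ((abs_im_le_norm _).trans_lt hw)
      simp at h1 h2
      refine ⟨?_, ?_, ?_⟩ <;> linarith
    have h1 := norm_le_of_re_le_max (f := f) (t := t) (Λ := Λ) (P := P) (Z := Z) (η := η)
      hη0 hΛ0.le hP0
      (hf.differentiableOn.mono fun w hw => ⟨(hb w hw).1, by
        have := (hb w hw).2.1
        change 0 < w.im
        linarith⟩)
      (fun w hw => hf.re_le (hb w hw).1 (hb w hw).2.1 (hb w hw).2.2)
      (hf.norm_le_log hη0 (by simp) (by simp; linarith)) (r := 1 + η - s.re)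
      (by linarith) (by linarith)
    have e : (1 + η - ((1 + η - s.re : ℝ) : ℂ) + t * I : ℂ) = s := by
      rw [ht]
      push_cast
      conv_rhs => rw [← re_add_im s]
      ring
    rw [e] at h1
    have h2 : (1 + η - s.re) / (1 / 2 + η - (1 + η - s.re)) ≤ (1 / 2 + η - δ) / δ := by
      rw [div_le_div_iff₀ (by linarith) hδ]
      nlinarith
    have h3 : ‖f s‖ ≤ Z + Λ / 3 + 2 * (P + 17 / 96 * Λ + Z) * ((1 / 2 + η - δ) / δ) := by
      refine h1.trans ?_
      rw [mul_div_assoc]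
      gcongr
    calc ‖f s‖ * δ ≤ (Z + Λ / 3 + 2 * (P + 17 / 96 * Λ + Z) * ((1 / 2 + η - δ) / δ)) * δ := by
          gcongr
      _ = (Z + Λ / 3) * δ + 2 * (P + 17 / 96 * Λ + Z) * (1 / 2 + η - δ) := by field_simp
      -- The term `-2δ (P + 17Λ/96 + Z)` pays for `(Z + Λ/3) δ`, because `17/48 > 1/3`.
      _ ≤ _ := by nlinarith [mul_pos hΛ0 hδ, mul_nonneg hZ0 hδ.le, mul_pos hP0 hδ]


/-! ### Three circles and the bound for `1/ζ` -/

lemma one_fourth_le_convexityK {C₁ T₂ : ℝ} (hC₁ : 0 < C₁) (hC₁' : C₁ ≤ 1)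
    (hT₂ : Real.exp (Real.exp 2) ≤ T₂) : 1 / 4 ≤ convexityK 1 1 1 1 C₁ T₂ := by
  have hT0 : 0 < T₂ := (Real.exp_pos _).trans_le hT₂
  have hL2 : Real.exp 2 ≤ Real.log T₂ := (Real.le_log_iff_exp_le hT0).mpr hT₂
  have hL0 : 0 < Real.log T₂ := (Real.exp_pos _).trans_le hL2
  have hl2 : 2 ≤ Real.log (Real.log T₂) := (Real.le_log_iff_exp_le hL0).mpr hL2
  have h1 : 0 ≤ Real.log (1 / C₁) := Real.log_nonneg (by rw [le_div_iff₀ hC₁]; linarith)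
  have h2 : 0 ≤ Real.log (Real.log (Real.log T₂)) := Real.log_nonneg (by linarith)
  have h3 := Real.one_half_lt_eulerMascheroniConstant
  rw [convexityK_zeta]
  have h4 : 0 ≤ C₁ / Real.log (Real.log T₂) := by positivity
  have h5 : 0 ≤ Real.log (Real.log T₂) / Real.log T₂ + (Real.log (Real.log (Real.log T₂)) +
      Real.log (1 / C₁) + Real.eulerMascheroniConstant * (C₁ / Real.log (Real.log T₂))) /
        Real.log T₂ := by positivity
  nlinarith

/-- Hadamard's three circles theorem applied to `log ζ`. -/
lemma IsLogZeta.norm_le_three_circles {f : ℂ → ℂ} (hf : IsLogZeta f) {C₁ T₂ δ X T σ : ℝ}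
    (hC₁ : 0 < C₁) (hC₁' : C₁ ≤ 1) (hT₂ : Real.exp (Real.exp 2) ≤ T₂) (hδ : 0 < δ)
    (hδ' : δ ≤ 1 / 2) (hX : 0 < X) (hT : T₂ ≤ T - X - 1 / 2) (hσ : 1 / 2 + δ ≤ σ)
    (hσ' : σ ≤ 1 + δ) :
    ‖f (σ + T * I)‖ ≤ 1 / δ * (convexityK 1 1 1 1 C₁ T₂ * Real.log (T + X + 3 / 2)) ^
      ((Real.log (X + 1 + δ - σ) - Real.log X) / (Real.log (X + 1 / 2) - Real.log X)) := by
  set K := convexityK 1 1 1 1 C₁ T₂ with hK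
  have hK0 : 1 / 4 ≤ K := one_fourth_le_convexityK hC₁ hC₁' hT₂
  set Λ := Real.log (T + X + 3 / 2) with hΛ
  have hTbig : 1001 < T₂ := exp_exp_two_gt.trans_le hT₂
  have hΛ0 : 0 < Λ := Real.log_pos (by linarith)
  -- About this centre the circle of radius `X` touches `Re s = 1 + δ` and the one of radius `X +
  -- 1/2` touches `Re s = 1/2 + δ`. The substitution `z₀ + exp u` turns the annulus into a vertical
  -- strip, so the three lines theorem applies.
  set z₀ : ℂ := ((1 + δ + X : ℝ) : ℂ) + T * I with hz₀
  have hre₀ : z₀.re = 1 + δ + X := by simp [hz₀]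
  have him₀ : z₀.im = T := by simp [hz₀]
  set F : ℂ → ℂ := fun u => f (z₀ + exp u) with hF
  set l := Real.log X with hl
  set m := Real.log (X + 1 / 2) with hm
  have hlm : l < m := Real.log_lt_log hX (by linarith)
  have hel : Real.exp l = X := Real.exp_log hX
  have hem : Real.exp m = X + 1 / 2 := Real.exp_log (by linarith)
  have hgeom : ∀ u : ℂ, u.re ≤ m → 1 / 2 + δ ≤ (z₀ + exp u).re ∧ T₂ ≤ (z₀ + exp u).im ∧
      (z₀ + exp u).im ≤ T + X + 1 / 2 := by
    intro u hu
    have h1 : ‖exp u‖ ≤ X + 1 / 2 := by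
      rw [norm_exp, ← hem]; exact Real.exp_le_exp.mpr hu
    have h2 := abs_le.mp ((abs_re_le_norm _).trans h1)
    have h3 := abs_le.mp ((abs_im_le_norm _).trans h1)
    rw [add_re, add_im, hre₀, him₀]
    refine ⟨?_, ?_, ?_⟩ <;> linarith
  have hbd : ∀ u : ℂ, u.re ≤ m → ‖F u‖ ≤ K * Λ / δ := by
    intro u hu
    obtain ⟨h1, h2, h3⟩ := hgeom u hu
    refine (hf.norm_le_convexityK hC₁ hC₁' hT₂ hδ hδ' h1 h2).trans ?_
    have : Real.log ((z₀ + exp u).im + 1) ≤ Λ := Real.log_le_log (by linarith) (by linarith)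
    rw [← hK]
    gcongr
  have hleft : ∀ u : ℂ, u.re = l → ‖F u‖ ≤ 1 / δ := by
    intro u hu
    have h1 : ‖exp u‖ ≤ X := by rw [norm_exp, hu, hel]
    have h2 := abs_le.mp ((abs_re_le_norm _).trans h1)
    have h3 : 1 + δ ≤ (z₀ + exp u).re := by rw [add_re, hre₀]; linarith
    obtain ⟨-, h5, -⟩ := hgeom u (by linarith)
    refine (hf.norm_le_log hδ h3 (by linarith)).trans ?_
    have := Real.log_le_sub_one_of_pos (show 0 < 1 + 1 / δ by positivity)
    linarith
  have hdiff : DiffContOnCl ℂ F (HadamardThreeLines.verticalStrip l m) := by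
    refine DifferentiableOn.diffContOnCl fun u hu => ?_
    have hu' : u ∈ HadamardThreeLines.verticalClosedStrip l m :=
      closure_minimal (preimage_mono Ioo_subset_Icc_self)
        (isClosed_Icc.preimage continuous_re) hu
    obtain ⟨h1, h2, -⟩ := hgeom u hu'.2
    have h3 : z₀ + exp u ∈ logZetaDomain :=
      ⟨show 1 / 2 < (z₀ + exp u).re by linarith, show 0 < (z₀ + exp u).im by linarith⟩
    have h4 : DifferentiableAt ℂ f (z₀ + exp u) :=
      hf.differentiableOn.differentiableAt (isOpen_logZetaDomain.mem_nhds h3)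
    exact (h4.comp u (by fun_prop : DifferentiableAt ℂ (fun u => z₀ + exp u) u)).differentiableWithinAt
  have hr0 : 0 < X + 1 + δ - σ := by linarith
  -- The imaginary part `π` points left from the centre, towards `σ + iT`.
  set u₀ : ℂ := (Real.log (X + 1 + δ - σ) : ℝ) + Real.pi * I with hu₀
  have hu₀re : u₀.re = Real.log (X + 1 + δ - σ) := by simp [hu₀]
  have hu₀e : z₀ + exp u₀ = σ + T * I := by
    rw [hu₀, exp_add, exp_pi_mul_I, ← ofReal_exp, Real.exp_log hr0, hz₀]
    push_cast
    ring
  have hmem : u₀ ∈ HadamardThreeLines.verticalClosedStrip l m := by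
    refine ⟨?_, ?_⟩
    · rw [hu₀re]; exact Real.log_le_log hX (by linarith)
    · rw [hu₀re]; exact Real.log_le_log hr0 (by linarith)
  have h := HadamardThreeLines.norm_le_interp_of_mem_verticalClosedStrip' hlm hmem hdiff
    ⟨K * Λ / δ, by rintro _ ⟨u, hu, rfl⟩; exact hbd u hu.2⟩ hleft
    (fun u hu => hbd u (le_of_eq hu))
  have hF0 : F u₀ = f (σ + T * I) := by rw [hF]; simp only [hu₀e]
  rw [hF0, hu₀re] at h
  refine h.trans (le_of_eq ?_)
  rw [show K * Λ / δ = 1 / δ * (K * Λ) by ring, Real.mul_rpow (by positivity) (by positivity),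
    ← mul_assoc, ← Real.rpow_add (by positivity), sub_add_cancel, Real.rpow_one]

/-- As `X → ∞` the ratio tends to the three-lines exponent `2y`; the last factor is the price of
finite radius. The denominator is estimated with `log(1 + v) ≥ 2v / (v + 2)` at `v = 1/(2X)`. -/
lemma log_ratio_le {X y : ℝ} (hX : 1 ≤ X) (hy : 0 ≤ y) :
    (Real.log (X + y) - Real.log X) / (Real.log (X + 1 / 2) - Real.log X) ≤
      2 * y * (1 - 1 / (4 * X))⁻¹ := by
  have hX0 : 0 < X := by linarith
  have h1 : Real.log (X + y) - Real.log X ≤ y / X := by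
    rw [← Real.log_div (by positivity) (by positivity)]
    refine (Real.log_le_sub_one_of_pos (by positivity)).trans (le_of_eq ?_)
    field_simp
    ring
  have hq : 0 < 1 - 1 / (4 * X) := by
    rw [sub_pos, div_lt_one (by positivity)]; linarith
  have h2 : 1 / (2 * X) * (1 - 1 / (4 * X)) ≤ Real.log (X + 1 / 2) - Real.log X := by
    rw [← Real.log_div (by positivity) (by positivity),
      show (X + 1 / 2) / X = 1 + 1 / (2 * X) by field_simp]
    refine le_trans ?_ (Real.le_log_one_add_of_nonneg (by positivity))
    rw [le_div_iff₀ (by positivity)]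
    have h3 : 0 < 1 / X := by positivity
    rw [show 1 / (2 * X) = 1 / X / 2 by field_simp, show 1 / (4 * X) = 1 / X / 4 by field_simp]
    generalize 1 / X = u at h3
    nlinarith [pow_pos h3 3]
  have h4 : 0 < 1 / (2 * X) * (1 - 1 / (4 * X)) := by positivity
  calc (Real.log (X + y) - Real.log X) / (Real.log (X + 1 / 2) - Real.log X)
      ≤ (y / X) / (1 / (2 * X) * (1 - 1 / (4 * X))) := by gcongr
    _ = _ := by field_simp

/-- The first part of `bZeta`. -/
noncomputable def bPrincipal (C₁ C₃ T₂ T : ℝ) : ℝ :=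
  convexityK 1 1 1 1 C₁ T₂ *
    (1 + Real.log (1 + (C₃ * Real.log (Real.log T) + 3 / 2) / T) / Real.log T)

lemma IsLogZeta.norm_le_rpow {f : ℂ → ℂ} (hf : IsLogZeta f) {C₁ C₂ C₃ T₂ T σ σ₀ : ℝ}
    (hC₁ : 0 < C₁) (hC₁' : C₁ ≤ 1) (hC₂ : 0 < C₂) (hC₃ : 1 ≤ C₃)
    (hT₂ : Real.exp (Real.exp 2) ≤ T₂) (hTe : Real.exp (Real.exp 2) ≤ T)
    (hC₂T : 2 * C₂ ≤ Real.log (Real.log T))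
    (hT : T₂ ≤ T - C₃ * Real.log (Real.log T) - 1 / 2)
    (hσ₀ : 1 / 2 + C₂ / Real.log (Real.log T) ≤ σ₀) (hσ₀' : σ₀ < 1) (hσ : σ₀ ≤ σ) :
    ‖f (σ + T * I)‖ ≤ Real.log (Real.log T) / C₂ * (bPrincipal C₁ C₃ T₂ T * Real.log T) ^
      (2 * (1 - σ₀) + calR C₂ C₃ T / Real.log (Real.log T)) := by
  have hT0 : 0 < T := (Real.exp_pos _).trans_le hTe
  set L := Real.log T with hL
  have hL2 : Real.exp 2 ≤ L := (Real.le_log_iff_exp_le hT0).mpr hTe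
  have hL0 : 0 < L := (Real.exp_pos _).trans_le hL2
  set l := Real.log L with hl
  have hl2 : 2 ≤ l := (Real.le_log_iff_exp_le hL0).mpr hL2
  have hl0 : 0 < l := by linarith
  set δ := C₂ / l with hδ
  have hδ0 : 0 < δ := by positivity
  have hδ1 : δ ≤ 1 / 2 := by rw [hδ, div_le_iff₀ hl0]; linarith
  set X := C₃ * l with hX
  have hX2 : 2 ≤ X := by nlinarith
  set K := convexityK 1 1 1 1 C₁ T₂ with hK
  have hK0 : 1 / 4 ≤ K := one_fourth_le_convexityK hC₁ hC₁' hT₂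
  have hbL : bPrincipal C₁ C₃ T₂ T * L = K * Real.log (T + X + 3 / 2) := by
    rw [bPrincipal, ← hK, ← hL, ← hl, ← hX,
      show T + X + 3 / 2 = T * (1 + (X + 3 / 2) / T) by field_simp; ring,
      Real.log_mul (by positivity) (by positivity), ← hL]
    field_simp
  have hLΛ : L ≤ Real.log (T + X + 3 / 2) := Real.log_le_log hT0 (by linarith)
  -- A base of at least `1` is needed to enlarge the exponent; `K ≥ 1/4` and `log T ≥ e² > 7.38`
  -- suffice.
  have hone : 1 ≤ K * Real.log (T + X + 3 / 2) := by
    nlinarith [exp_two_gt]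
  set q := (1 - 1 / (4 * X))⁻¹ with hq
  have hq' : 0 < 1 - 1 / (4 * X) := by
    rw [sub_pos, div_lt_one (by positivity)]; linarith
  have hq0 : 0 < q := inv_pos.mpr hq'
  have hq1 : q - 1 = q * (1 / (4 * X)) := by
    have : q * (1 - 1 / (4 * X)) = 1 := inv_mul_cancel₀ hq'.ne'
    linarith
  have hR : calR C₂ C₃ T / l = q * (2 * δ + 1 / (2 * X)) := by
    rw [calR, ← hL, ← hl, show 4 * C₃ * l = 4 * X by rw [hX]; ring, ← hq, hδ, hX]
    field_simp
  have hE : 0 ≤ 2 * (1 - σ₀) + calR C₂ C₃ T / l := by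
    rw [hR]
    have : 0 ≤ q * (2 * δ + 1 / (2 * X)) := by positivity
    linarith
  rw [hbL]
  have e1 : l / C₂ = 1 / δ := by rw [hδ]; field_simp
  rw [e1]
  rcases le_or_gt σ (1 + δ) with h | h
  · refine (hf.norm_le_three_circles hC₁ hC₁' hT₂ hδ0 hδ1 (by linarith : 0 < X) (by linarith)
      (hσ₀.trans hσ) h).trans ?_
    gcongr
    rw [show X + 1 + δ - σ = X + (1 + δ - σ) by ring]
    refine (log_ratio_le (by linarith) (by linarith)).trans ?_
    rw [hR, ← hq]
    have h1 : 0 ≤ q * (1 / (4 * X)) := by positivity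
    have h2 : 1 / (2 * X) = 2 * (1 / (4 * X)) := by field_simp; norm_num
    rw [h2]
    have h3 : 2 * (1 - σ) ≤ 1 := by linarith
    -- Since `2(1 - σ) ≤ 1`, the factor `q` costs the main term at most `q - 1 = q/(4X)`, half of
    -- the `q/(2X)` contained in `calR`.
    calc 2 * (1 + δ - σ) * q = 2 * (1 - σ) + 2 * (1 - σ) * (q - 1) + q * (2 * δ) := by ring
      _ ≤ 2 * (1 - σ₀) + 1 * (q - 1) + q * (2 * δ) := by
          have : 0 ≤ q - 1 := by rw [hq1]; exact h1
          gcongr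
      _ ≤ _ := by rw [hq1]; linarith
  · have h1 := hf.norm_le_log (s := σ + T * I) hδ0 (by simpa using h.le) (by simpa using hT0)
    have h2 := Real.log_le_sub_one_of_pos (show 0 < 1 + 1 / δ by positivity)
    have h3 := Real.one_le_rpow hone hE
    have h4 : 0 < 1 / δ := by positivity
    nlinarith

/-- Since `C₃ ≤ T₁`, the growth of `C₃ log log T` beyond `T₁` never exceeds `T - T₁`. Hence the room
above `T₂` required at `T₁` persists at every `T ≥ T₁`. -/
lemma mul_loglog_add_le {C₃ T₁ T : ℝ} (hC₃ : 1 ≤ C₃) (hT₁ : Real.exp (Real.exp 2) ≤ T₁)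
    (hT₁c : C₃ ≤ T₁) (hT : T₁ ≤ T) :
    T₁ - C₃ * Real.log (Real.log T₁) ≤ T - C₃ * Real.log (Real.log T) := by
  have hT0 : 0 < T₁ := (Real.exp_pos _).trans_le hT₁
  have hL2 : Real.exp 2 ≤ Real.log T₁ := (Real.le_log_iff_exp_le hT0).mpr hT₁
  have hL0 : 7 < Real.log T₁ := by linarith [exp_two_gt]
  have hLT : Real.log T₁ ≤ Real.log T := Real.log_le_log hT0 hT
  have h1 : Real.log (Real.log T) - Real.log (Real.log T₁) ≤ Real.log T - Real.log T₁ := by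
    rw [← Real.log_div (by linarith) (by linarith)]
    refine (Real.log_le_sub_one_of_pos (div_pos (by linarith) (by linarith))).trans ?_
    rw [div_sub_one (by linarith), div_le_iff₀ (by linarith)]
    nlinarith
  have h2 : Real.log T - Real.log T₁ ≤ (T - T₁) / T₁ := by
    rw [← Real.log_div (by linarith) (by linarith)]
    refine (Real.log_le_sub_one_of_pos (div_pos (by linarith) (by linarith))).trans ?_
    rw [div_sub_one (by linarith)]
  have h3 : C₃ * (Real.log (Real.log T) - Real.log (Real.log T₁)) ≤ T - T₁ := by
    calc C₃ * (Real.log (Real.log T) - Real.log (Real.log T₁)) ≤ C₃ * ((T - T₁) / T₁) := by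
          gcongr; exact h1.trans h2
      _ ≤ T₁ * ((T - T₁) / T₁) := by
          gcongr
      _ = T - T₁ := by field_simp
  linarith

/-- The principal part decreases in `T`, because `log log T / T` is a product of the decreasing
quotients `log log T / log T` and `log T / T`; the remaining factor of `bZeta` is at least `1`. -/
lemma bPrincipal_le_bZeta {C₁ C₃ T₁ T₂ T : ℝ} (hC₁ : 0 < C₁) (hC₁' : C₁ ≤ 1) (hC₃ : 1 ≤ C₃)
    (hT₂ : Real.exp (Real.exp 2) ≤ T₂) (hT₁ : Real.exp (Real.exp 2) ≤ T₁) (hT : T₁ ≤ T) :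
    bPrincipal C₁ C₃ T₂ T ≤ bZeta C₁ C₃ T₁ T₂ := by
  have hT0 : 0 < T₁ := (Real.exp_pos _).trans_le hT₁
  have hT0' : 0 < T := hT0.trans_le hT
  have hK0 := one_fourth_le_convexityK hC₁ hC₁' hT₂
  have hL2 : Real.exp 2 ≤ Real.log T₁ := (Real.le_log_iff_exp_le hT0).mpr hT₁
  have hL0 : 7 < Real.log T₁ := by linarith [exp_two_gt]
  have hl2 : 2 ≤ Real.log (Real.log T₁) := (Real.le_log_iff_exp_le (by linarith)).mpr hL2
  have hLT : Real.log T₁ ≤ Real.log T := Real.log_le_log hT0 hT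
  have hlT : Real.log (Real.log T₁) ≤ Real.log (Real.log T) :=
    Real.log_le_log (by linarith) hLT
  have he : Real.exp 1 ≤ Real.log T₁ := (Real.exp_le_exp.mpr (by norm_num)).trans hL2
  have he' : Real.exp 1 ≤ T₁ := (Real.exp_le_exp.mpr (by
    linarith [exp_two_gt])).trans hT₁
  have h1 : Real.log (Real.log T) / Real.log T ≤ Real.log (Real.log T₁) / Real.log T₁ :=
    Real.log_div_self_antitoneOn (show Real.log T₁ ∈ Ici (Real.exp 1) from he)
      (show Real.log T ∈ Ici (Real.exp 1) from he.trans hLT) hLT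
  have h2 : Real.log T / T ≤ Real.log T₁ / T₁ :=
    Real.log_div_self_antitoneOn (show T₁ ∈ Ici (Real.exp 1) from he')
      (show T ∈ Ici (Real.exp 1) from he'.trans hT) hT
  have h3 : Real.log (Real.log T) / T ≤ Real.log (Real.log T₁) / T₁ := by
    have e : ∀ t : ℝ, 7 < Real.log t → Real.log (Real.log t) / t =
        Real.log (Real.log t) / Real.log t * (Real.log t / t) := by
      intro t ht
      have : Real.log t ≠ 0 := by linarith
      field_simp
    rw [e T (by linarith), e T₁ hL0]
    have : 0 ≤ Real.log T / T := div_nonneg (by linarith) hT0'.le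
    gcongr
  have h4 : (C₃ * Real.log (Real.log T) + 3 / 2) / T ≤
      (C₃ * Real.log (Real.log T₁) + 3 / 2) / T₁ := by
    rw [add_div, add_div, mul_div_assoc, mul_div_assoc]
    gcongr
  have h5 : 0 ≤ (C₃ * Real.log (Real.log T) + 3 / 2) / T := by
    have : 0 ≤ C₃ * Real.log (Real.log T) := mul_nonneg (by linarith) (by linarith)
    positivity
  have h6 : Real.log (1 + (C₃ * Real.log (Real.log T) + 3 / 2) / T) / Real.log T ≤
      Real.log (1 + (C₃ * Real.log (Real.log T₁) + 3 / 2) / T₁) / Real.log T₁ := by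
    have h7 := Real.log_nonneg (show 1 ≤ 1 + (C₃ * Real.log (Real.log T₁) + 3 / 2) / T₁ by
      linarith)
    gcongr
  have h8 : 0 ≤ Real.log (1 + (C₃ * Real.log (Real.log T₁) + 3 / 2) / T₁) / Real.log T₁ :=
    div_nonneg (Real.log_nonneg (by linarith)) (by linarith)
  have h9 : 0 ≤ Real.log (1 + 1 / Real.log T₁ *
        Real.log (1 + (2 * C₃ * Real.log (Real.log T₁) + 1) / T₁)) / Real.log (Real.log T₁) := by
    have a1 : 0 ≤ (2 * C₃ * Real.log (Real.log T₁) + 1) / T₁ := by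
      have : 0 ≤ 2 * C₃ * Real.log (Real.log T₁) := mul_nonneg (by linarith) (by linarith)
      positivity
    have a2 : 0 ≤ 1 / Real.log T₁ *
        Real.log (1 + (2 * C₃ * Real.log (Real.log T₁) + 1) / T₁) :=
      mul_nonneg (by rw [one_div, inv_nonneg]; linarith) (Real.log_nonneg (by linarith))
    exact div_nonneg (Real.log_nonneg (by linarith)) (by linarith)
  rw [bPrincipal, bZeta, bOne, div_one, one_mul]
  calc convexityK 1 1 1 1 C₁ T₂ *
        (1 + Real.log (1 + (C₃ * Real.log (Real.log T) + 3 / 2) / T) / Real.log T)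
      ≤ convexityK 1 1 1 1 C₁ T₂ *
        (1 + Real.log (1 + (C₃ * Real.log (Real.log T₁) + 3 / 2) / T₁) / Real.log T₁) := by gcongr
    _ ≤ _ := le_mul_of_one_le_right (by positivity) (by linarith)

lemma calR_antitone {C₂ C₃ T₁ T : ℝ} (hC₂ : 0 < C₂) (hC₃ : 1 ≤ C₃)
    (hT₁ : Real.exp (Real.exp 2) ≤ T₁) (hT : T₁ ≤ T) :
    0 ≤ calR C₂ C₃ T ∧ calR C₂ C₃ T ≤ calR C₂ C₃ T₁ := by
  have hT0 : 0 < T₁ := (Real.exp_pos _).trans_le hT₁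
  have hL2 : Real.exp 2 ≤ Real.log T₁ := (Real.le_log_iff_exp_le hT0).mpr hT₁
  have hL0 : 0 < Real.log T₁ := (Real.exp_pos _).trans_le hL2
  have hl2 : 2 ≤ Real.log (Real.log T₁) := (Real.le_log_iff_exp_le hL0).mpr hL2
  have hlT : Real.log (Real.log T₁) ≤ Real.log (Real.log T) :=
    Real.log_le_log hL0 (Real.log_le_log hT0 hT)
  have h1 : 1 / (4 * C₃ * Real.log (Real.log T)) ≤ 1 / (4 * C₃ * Real.log (Real.log T₁)) := by
    gcongr
  have h2 : 0 < 1 - 1 / (4 * C₃ * Real.log (Real.log T₁)) := by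
    rw [sub_pos, div_lt_one (by positivity)]; nlinarith
  have h3 : 0 < 1 - 1 / (4 * C₃ * Real.log (Real.log T)) := by linarith
  unfold calR
  exact ⟨by positivity, by gcongr⟩

lemma bPrincipal_pos {C₁ C₃ T₁ T₂ : ℝ} (hC₁ : 0 < C₁) (hC₁' : C₁ ≤ 1) (hC₃ : 1 ≤ C₃)
    (hT₂ : Real.exp (Real.exp 2) ≤ T₂) (hT₁ : Real.exp (Real.exp 2) ≤ T₁) :
    0 < bPrincipal C₁ C₃ T₂ T₁ := by
  have hK0 := one_fourth_le_convexityK hC₁ hC₁' hT₂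
  have hT0 : 0 < T₁ := (Real.exp_pos _).trans_le hT₁
  have hL2 : Real.exp 2 ≤ Real.log T₁ := (Real.le_log_iff_exp_le hT0).mpr hT₁
  have hL0 : 0 < Real.log T₁ := (Real.exp_pos _).trans_le hL2
  have hl2 : 2 ≤ Real.log (Real.log T₁) := (Real.le_log_iff_exp_le hL0).mpr hL2
  have a1 : 0 ≤ (C₃ * Real.log (Real.log T₁) + 3 / 2) / T₁ := by positivity
  have a2 : 0 ≤ Real.log (1 + (C₃ * Real.log (Real.log T₁) + 3 / 2) / T₁) :=
    Real.log_nonneg (by linarith)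
  unfold bPrincipal
  positivity

lemma epsZero_pos {σ₀ C₁ C₂ C₃ T₁ T₂ : ℝ} (hC₁ : 0 < C₁) (hC₁' : C₁ ≤ 1) (hC₂ : 0 < C₂)
    (hC₃ : 1 ≤ C₃) (hT₂ : Real.exp (Real.exp 2) ≤ T₂) (hT₁ : Real.exp (Real.exp 2) ≤ T₁) :
    0 < epsZero σ₀ C₁ C₂ C₃ T₁ T₂ := by
  have hb : 0 < bZeta C₁ C₃ T₁ T₂ :=
    (bPrincipal_pos hC₁ hC₁' hC₃ hT₂ hT₁).trans_le (bPrincipal_le_bZeta hC₁ hC₁' hC₃ hT₂ hT₁ le_rfl)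
  have hT0 : 0 < T₁ := (Real.exp_pos _).trans_le hT₁
  have hL2 : Real.exp 2 ≤ Real.log T₁ := (Real.le_log_iff_exp_le hT0).mpr hT₁
  have hL0 : 0 < Real.log T₁ := (Real.exp_pos _).trans_le hL2
  have hl2 : 2 ≤ Real.log (Real.log T₁) := (Real.le_log_iff_exp_le hL0).mpr hL2
  unfold epsZero
  positivity

/-- The bound `|log ζ(σ + iT)| ≤ ε₀ log T`. -/
theorem IsLogZeta.norm_le_epsZero_mul_log {f : ℂ → ℂ} (hf : IsLogZeta f)
    {C₁ C₂ C₃ T₁ T₂ T σ σ₀ : ℝ}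
    (hC₁ : 0 < C₁) (hC₁' : C₁ ≤ 1) (hC₂ : 0 < C₂) (hC₃ : 1 ≤ C₃)
    (hT₂ : Real.exp (Real.exp 2) ≤ T₂) (hT₁ : Real.exp (Real.exp 2) ≤ T₁)
    (hT₁a : Real.exp (Real.exp (2 * C₂)) ≤ T₁) (hT₁c : C₃ ≤ T₁)
    (hT₁d : Real.exp (Real.exp (1 / (2 * σ₀ - 1))) ≤ T₁)
    (hT₁₂ : T₂ ≤ T₁ - C₃ * Real.log (Real.log T₁) - 1 / 2)
    (hσ₀ : 1 / 2 + C₂ / Real.log (Real.log T₁) ≤ σ₀) (hσ₀' : σ₀ < 1)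
    (hT : T₁ ≤ T) (hσ : σ₀ ≤ σ) :
    ‖f (σ + T * I)‖ ≤ epsZero σ₀ C₁ C₂ C₃ T₁ T₂ * Real.log T := by
  have hT0 : 0 < T₁ := (Real.exp_pos _).trans_le hT₁
  have hTe := hT₁.trans hT
  set L₁ := Real.log T₁ with hL₁
  have hL2 : Real.exp 2 ≤ L₁ := (Real.le_log_iff_exp_le hT0).mpr hT₁
  have hL0 : 0 < L₁ := (Real.exp_pos _).trans_le hL2
  set l₁ := Real.log L₁ with hl₁
  have hl2 : 2 ≤ l₁ := (Real.le_log_iff_exp_le hL0).mpr hL2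
  set L := Real.log T with hL
  have hLL : L₁ ≤ L := Real.log_le_log hT0 hT
  have hL0' : 0 < L := hL0.trans_le hLL
  set l := Real.log L with hl
  have hll : l₁ ≤ l := Real.log_le_log hL0 hLL
  have hl0 : 0 < l := by linarith
  have hC₂l : 2 * C₂ ≤ l₁ :=
    (Real.le_log_iff_exp_le hL0).mpr ((Real.le_log_iff_exp_le hT0).mpr hT₁a)
  have hδδ : C₂ / l ≤ C₂ / l₁ := by gcongr
  have hσ1 : 0 < 2 * σ₀ - 1 := by
    have : 0 < C₂ / l₁ := by positivity
    linarith
  have hmain := hf.norm_le_rpow (σ := σ) hC₁ hC₁' hC₂ hC₃ hT₂ hTe (by linarith)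
    (by linarith [mul_loglog_add_le hC₃ hT₁ hT₁c hT]) (by linarith) hσ₀' hσ
  rw [← hL, ← hl] at hmain
  refine hmain.trans ?_
  obtain ⟨hR0, hR⟩ := calR_antitone hC₂ hC₃ hT₁ hT
  set R := calR C₂ C₃ T with hRdef
  have hb := bPrincipal_le_bZeta hC₁ hC₁' hC₃ hT₂ hT₁ hT
  have hb0 : 0 < bPrincipal C₁ C₃ T₂ T := bPrincipal_pos hC₁ hC₁' hC₃ hT₂ hTe
  set b := bPrincipal C₁ C₃ T₂ T with hbdef
  -- `log L / L ^ a` decreases from `L = exp(1/a)` on; with `a = 2σ₀ - 1` this is the doubly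
  -- exponential condition on `T₁`.
  have hmono : l / L ^ (2 * σ₀ - 1) ≤ l₁ / L₁ ^ (2 * σ₀ - 1) := by
    have hx : Real.exp (2 * σ₀ - 1)⁻¹ ≤ L₁ := by
      rw [← one_div]
      exact (Real.le_log_iff_exp_le hT0).mpr hT₁d
    exact Real.log_div_self_rpow_antitoneOn hσ1 (show L₁ ∈ Ici _ from hx)
      (show L ∈ Ici _ from hx.trans hLL) hLL
  -- Because `l = log L`, the power `L ^ (R / l)` is just `exp R`, and `2(1 - σ₀) = 1 - (2σ₀ - 1)`
  -- isolates one factor `L`.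
  have e1 : (b * L) ^ (2 * (1 - σ₀) + R / l) =
      b ^ (2 * (1 - σ₀)) * Real.exp ((1 + Real.log b / l) * R) * (L / L ^ (2 * σ₀ - 1)) := by
    rw [Real.rpow_add (by positivity), Real.mul_rpow hb0.le hL0'.le,
      Real.rpow_def_of_pos (by positivity : 0 < b * L) (R / l),
      Real.log_mul hb0.ne' hL0'.ne', ← hl, show 2 * (1 - σ₀) = 1 - (2 * σ₀ - 1) by ring,
      Real.rpow_sub hL0' 1, Real.rpow_one,
      show (Real.log b + l) * (R / l) = (1 + Real.log b / l) * R by field_simp; ring]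
    ring
  have hpl : Real.log b / l ≤ Real.posLog (bZeta C₁ C₃ T₁ T₂) / l₁ := by
    have h1 : Real.log b ≤ Real.posLog (bZeta C₁ C₃ T₁ T₂) :=
      (Real.log_le_log hb0 hb).trans (le_max_right _ _)
    have h2 : 0 ≤ Real.posLog (bZeta C₁ C₃ T₁ T₂) := Real.posLog_nonneg
    calc Real.log b / l ≤ Real.posLog (bZeta C₁ C₃ T₁ T₂) / l := by gcongr
      _ ≤ _ := by gcongr
  have hexp : (1 + Real.log b / l) * R ≤
      (1 + Real.posLog (bZeta C₁ C₃ T₁ T₂) / l₁) * calR C₂ C₃ T₁ := by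
    have h2 : 0 ≤ Real.posLog (bZeta C₁ C₃ T₁ T₂) / l₁ :=
      div_nonneg Real.posLog_nonneg (by linarith)
    calc (1 + Real.log b / l) * R ≤ (1 + Real.posLog (bZeta C₁ C₃ T₁ T₂) / l₁) * R := by gcongr
      _ ≤ _ := by gcongr
  rw [e1]
  have hbp : b ^ (2 * (1 - σ₀)) ≤ bZeta C₁ C₃ T₁ T₂ ^ (2 * (1 - σ₀)) :=
    Real.rpow_le_rpow hb0.le hb (by linarith)
  calc l / C₂ * (b ^ (2 * (1 - σ₀)) * Real.exp ((1 + Real.log b / l) * R) *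
        (L / L ^ (2 * σ₀ - 1)))
      = 1 / C₂ * b ^ (2 * (1 - σ₀)) * Real.exp ((1 + Real.log b / l) * R) *
        (l / L ^ (2 * σ₀ - 1)) * L := by ring
    _ ≤ epsZero σ₀ C₁ C₂ C₃ T₁ T₂ * L := by
        unfold epsZero
        have hbz : 0 < bZeta C₁ C₃ T₁ T₂ := hb0.trans_le hb
        gcongr

/-- A bound for `1 / ζ` to the right of the critical line under the Riemann hypothesis. -/
theorem RiemannHypothesis.norm_inv_riemannZeta_le (hRH : RiemannHypothesis)
    {C₁ C₂ C₃ T₁ T₂ t σ σ₀ : ℝ}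
    (hC₁ : 0 < C₁) (hC₁' : C₁ ≤ 1) (hC₂ : 0 < C₂) (hC₃ : 1 ≤ C₃)
    (hT₂ : Real.exp (Real.exp 2) ≤ T₂) (hT₁ : Real.exp (Real.exp 2) ≤ T₁)
    (hT₁a : Real.exp (Real.exp (2 * C₂)) ≤ T₁) (hT₁c : C₃ ≤ T₁)
    (hT₁d : Real.exp (Real.exp (1 / (2 * σ₀ - 1))) ≤ T₁)
    (hT₁₂ : T₂ ≤ T₁ - C₃ * Real.log (Real.log T₁) - 1 / 2)
    (hσ₀ : 1 / 2 + C₂ / Real.log (Real.log T₁) ≤ σ₀) (hσ₀' : σ₀ < 1)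
    (ht : T₁ ≤ t) (hσ : σ₀ ≤ σ) :
    1 / ‖riemannZeta (σ + t * I)‖ ≤ t ^ epsZero σ₀ C₁ C₂ C₃ T₁ T₂ := by
  obtain ⟨f, hf1, hf2, hf3⟩ := hRH.exists_log_riemannZeta
  have hf : IsLogZeta f := ⟨hf1, hf2, hf3⟩
  have hT0 : 0 < T₁ := (Real.exp_pos _).trans_le hT₁
  have hl : 0 < Real.log (Real.log T₁) := by
    have hL2 : Real.exp 2 ≤ Real.log T₁ := (Real.le_log_iff_exp_le hT0).mpr hT₁
    have := (Real.le_log_iff_exp_le ((Real.exp_pos _).trans_le hL2)).mpr hL2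
    linarith
  have h1 := hf.norm_le_epsZero_mul_log hC₁ hC₁' hC₂ hC₃ hT₂ hT₁ hT₁a hT₁c hT₁d hT₁₂ hσ₀ hσ₀' ht hσ
  have hmem : (σ + t * I : ℂ) ∈ logZetaDomain := by
    constructor
    · have : 0 < C₂ / Real.log (Real.log T₁) := by positivity
      simp
      linarith
    · simp
      linarith
  rw [← hf.exp_eq _ hmem, norm_exp, one_div, ← Real.exp_neg, Real.rpow_def_of_pos (by linarith),
    Real.exp_le_exp, mul_comm (Real.log t)]
  have h2 := abs_re_le_norm (f (σ + t * I))
  linarith [neg_abs_le (f (σ + t * I)).re]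


/-! ### The smoothed Perron formula on `Re s = 2` -/

/-- The Mellin transform of `u ↦ max 0 (1 - u)` is `1 / (s (s + 1))`. -/
lemma hasMellin_max_zero_one_sub {s : ℂ} (hs : 0 < s.re) :
    HasMellin (fun u : ℝ => (Ioc 0 1).indicator (fun _ => (1 : ℂ)) u -
      (Ioc 0 1).indicator (fun t : ℝ => (t : ℂ) ^ (1 : ℂ)) u) s (1 / (s * (s + 1))) := by
  have h1 := hasMellin_one_Ioc hs
  have h2 := hasMellin_cpow_Ioc 1 (s := s) (by simp; linarith)
  have h3 := hasMellin_sub h1.1 h2.1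
  have hs0 : s ≠ 0 := by rintro rfl; simp at hs
  have hs1 : s + 1 ≠ 0 := by
    intro h
    have := congrArg re h
    simp at this
    linarith
  refine ⟨h3.1, h3.2.trans ?_⟩
  rw [h1.2, h2.2]
  field_simp
  ring

lemma indicator_sub_indicator_eq {u : ℝ} (hu : 0 < u) :
    (Ioc 0 1).indicator (fun _ => (1 : ℂ)) u -
      (Ioc 0 1).indicator (fun t : ℝ => (t : ℂ) ^ (1 : ℂ)) u = ((max 0 (1 - u) : ℝ) : ℂ) := by
  by_cases h : u ≤ 1
  · have : u ∈ Ioc (0 : ℝ) 1 := ⟨hu, h⟩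
    rw [indicator_of_mem this, indicator_of_mem this, max_eq_right (by linarith)]
    simp
  · have : u ∉ Ioc (0 : ℝ) 1 := fun h' => h h'.2
    rw [indicator_of_notMem this, indicator_of_notMem this, max_eq_left (by linarith)]
    simp

lemma sq_le_norm_mul_add_one (s : ℂ) : s.im ^ 2 ≤ ‖s‖ * ‖s + 1‖ := by
  have h1 := abs_im_le_norm s
  have h2 := abs_im_le_norm (s + 1)
  simp only [add_im, one_im, add_zero] at h2
  rw [← sq_abs, sq]
  gcongr

lemma norm_one_div_mul_add_one_le (t : ℝ) :
    ‖1 / ((2 + t * I : ℂ) * (2 + t * I + 1))‖ ≤ (1 + t ^ 2)⁻¹ := by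
  have h1 : 1 + t ^ 2 ≤ ‖(2 + t * I : ℂ) * (2 + t * I + 1)‖ := by
    have h2 : (2 + t * I : ℂ) * (2 + t * I + 1) = ((6 - t ^ 2 : ℝ) : ℂ) + ((5 * t : ℝ) : ℂ) * I := by
      push_cast
      linear_combination (t : ℂ) ^ 2 * I_sq
    rw [h2]
    refine le_of_sq_le_sq ?_ (norm_nonneg _)
    rw [Complex.sq_norm, normSq_add_mul_I]
    nlinarith [sq_nonneg t]
  rw [norm_div, norm_one, ← one_div]
  gcongr

lemma continuous_one_div_mul_add_one :
    Continuous fun t : ℝ => 1 / ((2 + t * I : ℂ) * (2 + t * I + 1)) := by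
  refine Continuous.div continuous_const (by fun_prop) fun t => mul_ne_zero ?_ ?_
  · intro h; have := congrArg re h; simp at this
  · intro h; have := congrArg re h; norm_num at this

lemma integrable_one_div_mul_add_one :
    Integrable fun t : ℝ => 1 / ((2 + t * I : ℂ) * (2 + t * I + 1)) :=
  integrable_inv_one_add_sq.mono' continuous_one_div_mul_add_one.aestronglyMeasurable
    (Eventually.of_forall norm_one_div_mul_add_one_le)

/-- Mellin inversion on `Re s = 2`; it applies because the transform decays quadratically and the
tent function is continuous at `y`. -/
lemma integral_cpow_mul_one_div {y : ℝ} (hy : 0 < y) :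
    ∫ t : ℝ, (y : ℂ) ^ (-(2 + t * I)) * (1 / ((2 + t * I : ℂ) * (2 + t * I + 1))) =
      2 * Real.pi * (max 0 (1 - y) : ℝ) := by
  set k : ℝ → ℂ := fun u : ℝ => (Ioc 0 1).indicator (fun _ => (1 : ℂ)) u -
      (Ioc 0 1).indicator (fun t : ℝ => (t : ℂ) ^ (1 : ℂ)) u with hk
  have hm : ∀ t : ℝ, mellin k ((2 : ℝ) + t * I) = 1 / ((2 + t * I : ℂ) * (2 + t * I + 1)) := by
    intro t
    rw [hk, (hasMellin_max_zero_one_sub (s := (2 : ℝ) + t * I) (by simp)).2]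
    norm_num
  have h1 : mellinInv 2 (mellin k) y = k y := by
    refine mellinInv_mellin_eq 2 k hy (hasMellin_max_zero_one_sub (s := (2 : ℝ)) (by simp)).1 ?_ ?_
    · exact integrable_one_div_mul_add_one.congr (Eventually.of_forall fun t => (hm t).symm)
    · have h2 : Continuous fun u : ℝ => ((max 0 (1 - u) : ℝ) : ℂ) := by fun_prop
      refine h2.continuousAt.congr ?_
      filter_upwards [lt_mem_nhds hy] with u hu using (indicator_sub_indicator_eq hu).symm
  have h2 : k y = (max 0 (1 - y) : ℝ) := indicator_sub_indicator_eq hy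
  rw [← h2, ← h1, mellinInv, real_smul]
  simp_rw [hm, smul_eq_mul]
  push_cast
  have hpi : (Real.pi : ℂ) ≠ 0 := by exact_mod_cast Real.pi_ne_zero
  rw [← mul_assoc, mul_one_div_cancel (mul_ne_zero two_ne_zero hpi), one_mul]

/-- The smoothed summatory function of the Möbius function. -/
noncomputable def smoothMertens (X : ℝ) : ℝ :=
  ∑ n ∈ Finset.Icc 1 ⌊X⌋₊, (ArithmeticFunction.moebius n : ℝ) * (X - n)

lemma natCast_div_cpow {X : ℝ} (hX : 0 < X) (n : ℕ) (s : ℂ) :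
    ((n / X : ℝ) : ℂ) ^ (-s) = (X : ℂ) ^ s * (1 / (n : ℂ) ^ s) := by
  rw [ofReal_div, div_cpow_ofReal_nonneg (Nat.cast_nonneg n) hX.le, cpow_neg, cpow_neg,
    ofReal_natCast]
  field_simp

/-- A smoothed version of Perron's formula for the Möbius function. -/
lemma integral_perron_smoothMertens {X : ℝ} (hX : 0 < X) :
    ∫ t : ℝ, (X : ℂ) ^ (2 + t * I + 1) / ((2 + t * I) * (2 + t * I + 1)) /
        riemannZeta (2 + t * I) = 2 * Real.pi * smoothMertens X := by
  set κ : ℝ → ℂ := fun t => 1 / ((2 + t * I : ℂ) * (2 + t * I + 1)) with hκ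
  set F : ℕ → ℝ → ℂ := fun n t =>
    ((ArithmeticFunction.moebius n : ℝ) * X : ℝ) * (((n / X : ℝ) : ℂ) ^ (-(2 + t * I)) * κ t) with hF
  have hX0 : (X : ℂ) ≠ 0 := by exact_mod_cast hX.ne'
  have hF0 : F 0 = 0 := by ext t; simp [hF]
  -- On `Re s = 2` the terms are dominated by `n⁻² (1 + t²)⁻¹`, which justifies exchanging sum and
  -- integral.
  have hnorm : ∀ n : ℕ, ∀ t : ℝ, ‖F n t‖ ≤ X ^ 3 * (1 / (n : ℝ) ^ 2) * (1 + t ^ 2)⁻¹ := by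
    intro n t
    rcases Nat.eq_zero_or_pos n with rfl | hn
    · simp [hF0]
    have hn' : (0 : ℝ) < n := by exact_mod_cast hn
    simp only [hF]
    rw [norm_mul, norm_mul, norm_cpow_eq_rpow_re_of_pos (by positivity), norm_real, norm_mul,
      Real.norm_of_nonneg hX.le]
    have h1 : ‖(ArithmeticFunction.moebius n : ℝ)‖ ≤ 1 := by
      rw [Real.norm_eq_abs]
      exact_mod_cast ArithmeticFunction.abs_moebius_le_one
    have h2 : (-(2 + t * I : ℂ)).re = -((2 : ℕ) : ℝ) := by simp
    rw [h2, Real.rpow_neg (by positivity), Real.rpow_natCast]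
    calc ‖(ArithmeticFunction.moebius n : ℝ)‖ * X * (((n / X : ℝ) ^ 2)⁻¹ * ‖κ t‖)
        ≤ 1 * X * (((n / X : ℝ) ^ 2)⁻¹ * (1 + t ^ 2)⁻¹) := by
          gcongr
          exact norm_one_div_mul_add_one_le t
      _ = _ := by field_simp
  have hcont : ∀ n : ℕ, Continuous (F n) := by
    intro n
    rcases Nat.eq_zero_or_pos n with rfl | hn
    · rw [hF0]; exact continuous_const
    have hne : ((n / X : ℝ) : ℂ) ≠ 0 := by
      have : (0 : ℝ) < n := by exact_mod_cast hn
      exact_mod_cast (div_pos this hX).ne'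
    refine continuous_const.mul (Continuous.mul ?_ continuous_one_div_mul_add_one)
    exact Continuous.const_cpow (by fun_prop) (Or.inl hne)
  have hint : ∀ n, Integrable (F n) := fun n =>
    (integrable_inv_one_add_sq.const_mul _).mono' (hcont n).aestronglyMeasurable
      (Eventually.of_forall (hnorm n))
  have hsum : Summable fun n => ∫ t, ‖F n t‖ := by
    refine Summable.of_nonneg_of_le (fun n => integral_nonneg fun t => norm_nonneg _)
      (fun n => integral_mono (hint n).norm (integrable_inv_one_add_sq.const_mul _) (hnorm n)) ?_
    simp_rw [integral_const_mul]
    exact ((Real.summable_one_div_nat_pow.mpr (by norm_num)).mul_left _).mul_right _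
  have h1 := hasSum_integral_of_summable_integral_norm hint hsum
  have hval : ∀ n : ℕ, ∫ t, F n t =
      2 * Real.pi * (((ArithmeticFunction.moebius n : ℝ) * max 0 (X - n) : ℝ) : ℂ) := by
    intro n
    rcases Nat.eq_zero_or_pos n with rfl | hn
    · simp [hF0]
    have hn' : (0 : ℝ) < n := by exact_mod_cast hn
    simp only [hF]
    rw [integral_const_mul, integral_cpow_mul_one_div (by positivity)]
    have h2 : max 0 (X - n) = X * max 0 (1 - n / X) := by
      rw [mul_max_of_nonneg _ _ hX.le, mul_zero, mul_sub, mul_div_cancel₀ _ hX.ne', mul_one]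
    rw [h2]
    push_cast
    ring
  have hfin : HasSum (fun n : ℕ => ∫ t, F n t) (2 * Real.pi * smoothMertens X) := by
    have h3 : ∑ n ∈ Finset.Icc 1 ⌊X⌋₊, ∫ t, F n t = 2 * Real.pi * smoothMertens X := by
      rw [smoothMertens, ofReal_sum, Finset.mul_sum]
      refine Finset.sum_congr rfl fun n hn => ?_
      rw [hval, max_eq_right]
      rw [sub_nonneg]
      exact (Nat.le_floor_iff hX.le).mp (Finset.mem_Icc.mp hn).2
    rw [← h3]
    refine hasSum_sum_of_ne_finset_zero fun n hn => ?_
    rcases Nat.eq_zero_or_pos n with rfl | hn1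
    · simp [hF0]
    rw [hval, max_eq_left]
    · simp
    · rw [Finset.mem_Icc, not_and, not_le] at hn
      have := (Nat.floor_lt hX.le).mp (hn hn1)
      linarith
  rw [← h1.unique hfin]
  refine integral_congr_ae (Eventually.of_forall fun t => ?_)
  have hre : 1 < (2 + t * I : ℂ).re := by simp
  have hμ := (ArithmeticFunction.LSeriesSummable_moebius_iff.mpr hre).hasSum
  have hmul := LSeries_one_mul_Lseries_moebius hre
  rw [LSeries_one_eq_riemannZeta hre] at hmul
  have hterm : ∀ n : ℕ, F n t = X * (X : ℂ) ^ (2 + t * I : ℂ) * κ t *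
      LSeries.term (fun n => ((ArithmeticFunction.moebius n : ℤ) : ℂ)) (2 + t * I) n := by
    intro n
    rcases Nat.eq_zero_or_pos n with rfl | hn
    · simp [hF0]
    simp only [hF]
    rw [natCast_div_cpow hX, LSeries.term_of_ne_zero hn.ne']
    push_cast
    ring
  simp only
  simp_rw [hterm]
  rw [(hμ.mul_left _).tsum_eq]
  have hz := riemannZeta_ne_zero_of_one_lt_re hre
  have hL : ∑' n, LSeries.term (fun n => ((ArithmeticFunction.moebius n : ℤ) : ℂ)) (2 + t * I) n =
      1 / riemannZeta (2 + t * I) := by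
    rw [eq_div_iff hz, mul_comm]
    exact hmul
  rw [hL, cpow_add _ _ hX0, cpow_one, hκ]
  ring

/-- Moving a vertical line of integration. -/
lemma integral_vertical_eq_of_tendsto {G : ℂ → ℂ} {a b T₀ : ℝ} {ω : ℝ → ℝ} (hab : a ≤ b)
    (hG : ∀ s : ℂ, a ≤ s.re → DifferentiableAt ℂ G s)
    (ha : Integrable fun t : ℝ => G (a + t * I)) (hb : Integrable fun t : ℝ => G (b + t * I))
    (hω : Tendsto ω atTop (𝓝 0))
    (hbd : ∀ σ ∈ Icc a b, ∀ t : ℝ, T₀ ≤ t → ‖G (σ + t * I)‖ ≤ ω t)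
    (hbd' : ∀ σ ∈ Icc a b, ∀ t : ℝ, T₀ ≤ t → ‖G (σ + (-t : ℝ) * I)‖ ≤ ω t) :
    ∫ t : ℝ, G (b + t * I) = ∫ t : ℝ, G (a + t * I) := by
  -- Cauchy's theorem on the rectangle of height `±Y`; the horizontal sides have fixed length and
  -- vanish with `ω Y`.
  have hrect : ∀ Y : ℝ, (∫ t in (-Y)..Y, G (b + t * I)) - ∫ t in (-Y)..Y, G (a + t * I) =
      I * ((∫ σ in a..b, G (σ + (-Y : ℝ) * I)) - ∫ σ in a..b, G (σ + Y * I)) := by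
    intro Y
    have h := integral_boundary_rect_eq_zero_of_differentiableOn G ⟨a, -Y⟩ ⟨b, Y⟩ (by
      intro s hs
      refine (hG s ?_).differentiableWithinAt
      have := (mem_reProdIm.mp hs).1
      simp only [uIcc_of_le hab] at this
      exact this.1)
    simp only [smul_eq_mul] at h
    linear_combination (-I) * h + ((∫ t in (-Y)..Y, G (b + t * I)) -
      ∫ t in (-Y)..Y, G (a + t * I)) * I_sq
  have hlim : Tendsto (fun Y : ℝ => I * ((∫ σ in a..b, G (σ + (-Y : ℝ) * I)) -
      ∫ σ in a..b, G (σ + Y * I))) atTop (𝓝 0) := by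
    have h1 : Tendsto (fun Y => 2 * (ω Y * (b - a))) atTop (𝓝 0) := by
      simpa using (hω.mul_const (b - a)).const_mul 2
    refine squeeze_zero_norm' ?_ h1
    filter_upwards [eventually_ge_atTop T₀] with Y hY
    have e1 : ‖∫ σ in a..b, G (σ + (-Y : ℝ) * I)‖ ≤ ω Y * |b - a| :=
      intervalIntegral.norm_integral_le_of_norm_le_const fun σ hσ => by
        rw [uIoc_of_le hab] at hσ
        exact hbd' σ ⟨hσ.1.le, hσ.2⟩ Y hY
    have e2 : ‖∫ σ in a..b, G (σ + Y * I)‖ ≤ ω Y * |b - a| :=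
      intervalIntegral.norm_integral_le_of_norm_le_const fun σ hσ => by
        rw [uIoc_of_le hab] at hσ
        exact hbd σ ⟨hσ.1.le, hσ.2⟩ Y hY
    rw [abs_of_nonneg (by linarith)] at e1 e2
    rw [norm_mul, norm_I, one_mul]
    refine (norm_sub_le _ _).trans ?_
    linarith
  have hA := intervalIntegral_tendsto_integral ha tendsto_neg_atTop_atBot tendsto_id
  have hB := intervalIntegral_tendsto_integral hb tendsto_neg_atTop_atBot tendsto_id
  have h2 := (hB.sub hA).congr hrect
  exact sub_eq_zero.mp (tendsto_nhds_unique h2 hlim)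

lemma integrable_of_norm_le_rpow {g : ℝ → ℂ} (hg : Continuous g) (heven : ∀ t, ‖g (-t)‖ = ‖g t‖)
    {C T₀ ε : ℝ} (hε : ε < 1) (hT₀ : 0 < T₀) (hbd : ∀ t, T₀ ≤ t → ‖g t‖ ≤ C * t ^ (ε - 2)) :
    Integrable g := by
  refine hg.locallyIntegrable.integrable_of_isBigO_atTop_of_norm_isNegInvariant
    (g := fun t : ℝ => t ^ (ε - 2)) (Eventually.of_forall fun t => (heven t).symm) ?_
    ⟨Ioi T₀, Ioi_mem_atTop T₀, integrableOn_Ioi_rpow_of_lt (by linarith) hT₀⟩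
  refine Asymptotics.IsBigO.of_bound C ?_
  filter_upwards [eventually_ge_atTop T₀] with t ht
  rw [Real.norm_of_nonneg (by have := hT₀.trans_le ht; positivity)]
  exact hbd t ht


/-! ### Differencing and the shift to `Re s = σ₀` -/

/-- Every `n ≤ x` contributes `h μ(n)` to the difference of smoothed sums. What remains are the
integers in `(x, x + h]`, at most `h + 1` of them, each with weight at most `h`. -/
lemma abs_mul_mertens_sub_le {x h : ℝ} (hx : 0 ≤ x) (hh : 0 ≤ h) :
    |h * mertens x - (smoothMertens (x + h) - smoothMertens x)| ≤ h * (h + 1) := by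
  have hIcc : ∀ m : ℕ, Finset.Icc 1 m = Finset.Ioc 0 m := fun m => by
    ext n; simp [Nat.succ_le_iff]
  have hfl : ⌊x⌋₊ ≤ ⌊x + h⌋₊ := Nat.floor_mono (by linarith)
  have key : h * mertens x - (smoothMertens (x + h) - smoothMertens x) =
      -∑ n ∈ Finset.Ioc ⌊x⌋₊ ⌊x + h⌋₊, (ArithmeticFunction.moebius n : ℝ) * (x + h - n) := by
    rw [mertens, smoothMertens, smoothMertens, hIcc, hIcc,
      ← Finset.sum_Ioc_consecutive _ (Nat.zero_le ⌊x⌋₊) hfl, Finset.mul_sum]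
    rw [← sub_eq_zero]
    have : ∑ n ∈ Finset.Ioc 0 ⌊x⌋₊, (ArithmeticFunction.moebius n : ℝ) * (x + h - n) =
        ∑ n ∈ Finset.Ioc 0 ⌊x⌋₊, h * (ArithmeticFunction.moebius n : ℝ) +
        ∑ n ∈ Finset.Ioc 0 ⌊x⌋₊, (ArithmeticFunction.moebius n : ℝ) * (x - n) := by
      rw [← Finset.sum_add_distrib]
      exact Finset.sum_congr rfl fun n _ => by ring
    rw [this]
    ring
  rw [key, abs_neg]
  have hterm : ∀ n ∈ Finset.Ioc ⌊x⌋₊ ⌊x + h⌋₊,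
      |(ArithmeticFunction.moebius n : ℝ) * (x + h - n)| ≤ h := by
    intro n hn
    obtain ⟨h1, h2⟩ := Finset.mem_Ioc.mp hn
    have h3 := (Nat.floor_lt hx).mp h1
    have h4 := (Nat.le_floor_iff (by linarith)).mp h2
    have h5 : |(ArithmeticFunction.moebius n : ℝ)| ≤ 1 := by
      exact_mod_cast ArithmeticFunction.abs_moebius_le_one
    rw [abs_mul, abs_of_nonneg (show 0 ≤ x + h - n by linarith)]
    nlinarith [abs_nonneg (ArithmeticFunction.moebius n : ℝ)]
  refine (Finset.abs_sum_le_sum_abs _ _).trans ((Finset.sum_le_card_nsmul _ _ _ hterm).trans ?_)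
  rw [Nat.card_Ioc, nsmul_eq_mul, mul_comm, Nat.cast_sub hfl]
  have h1 : (⌊x + h⌋₊ : ℝ) ≤ x + h := Nat.floor_le (by linarith)
  have h2 : x < ⌊x⌋₊ + 1 := Nat.lt_floor_add_one x
  gcongr
  linarith

/-- The kernel of the smoothed Perron formula on an interval `[x, x + h]`. -/
noncomputable def perronKernel (x h : ℝ) (s : ℂ) : ℂ :=
  (((x + h : ℝ) : ℂ) ^ (s + 1) - (x : ℂ) ^ (s + 1)) / (s + 1)

/-- The kernel is `∫ v ^ s` over `[x, x + h]`. This bound gains the factor `h` and serves at low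
heights. -/
lemma norm_perronKernel_le {x h : ℝ} (hx : 0 < x) (hh : 0 ≤ h) {s : ℂ} (hs : 0 ≤ s.re) :
    ‖perronKernel x h s‖ ≤ h * (x + h) ^ s.re := by
  have h1 : perronKernel x h s = ∫ v in x..(x + h), (v : ℂ) ^ s := by
    rw [integral_cpow (Or.inl (by linarith)), perronKernel]
  rw [h1]
  have h2 : ‖∫ v in x..(x + h), (v : ℂ) ^ s‖ ≤ (x + h) ^ s.re * |x + h - x| := by
    refine intervalIntegral.norm_integral_le_of_norm_le_const fun v hv => ?_
    rw [uIoc_of_le (by linarith)] at hv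
    rw [norm_cpow_eq_rpow_re_of_pos (hx.trans hv.1)]
    exact Real.rpow_le_rpow (hx.trans hv.1).le hv.2 hs
  rw [add_sub_cancel_left, abs_of_nonneg hh] at h2
  linarith

/-- The trivial bound gives up the factor `h` for decay in `‖s + 1‖`, which makes the tail
integrable. -/
lemma norm_perronKernel_le_div {x h : ℝ} (hx : 0 < x) (hh : 0 ≤ h) {s : ℂ} (hs : 0 ≤ s.re) :
    ‖perronKernel x h s‖ ≤ 2 * (x + h) ^ (s.re + 1) / ‖s + 1‖ := by
  rw [perronKernel, norm_div]
  gcongr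
  refine (norm_sub_le _ _).trans ?_
  rw [norm_cpow_eq_rpow_re_of_pos hx, norm_cpow_eq_rpow_re_of_pos (by linarith), add_re, one_re]
  have := Real.rpow_le_rpow hx.le (show x ≤ x + h by linarith) (show 0 ≤ s.re + 1 by linarith)
  linarith

lemma norm_perronKernel_conj {x h : ℝ} (hx : 0 < x) (hh : 0 ≤ h) (s : ℂ) :
    ‖perronKernel x h (starRingEnd ℂ s)‖ = ‖perronKernel x h s‖ := by
  have h1 : ∀ y : ℝ, 0 < y → (y : ℂ) ^ (starRingEnd ℂ s + 1) =
      starRingEnd ℂ ((y : ℂ) ^ (s + 1)) := by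
    intro y hy
    have := cpow_conj (y : ℂ) (s + 1) (by rw [arg_ofReal_of_nonneg hy.le]; exact Real.pi_ne_zero.symm)
    simpa using this
  rw [← norm_conj (perronKernel x h s)]
  congr 1
  rw [perronKernel, perronKernel, h1 _ hx, h1 _ (by linarith)]
  simp

/-- The integrand of the smoothed Perron formula for `1 / ζ`, without singularity at `1`. -/
noncomputable def perronIntegrand (x h : ℝ) (s : ℂ) : ℂ :=
  perronKernel x h s / s * ((s - 1) / riemannZeta₁ s)

lemma perronIntegrand_eq (x h : ℝ) {s : ℂ} (hs : s ≠ 1) :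
    perronIntegrand x h s = perronKernel x h s / s / riemannZeta s := by
  have : s - 1 ≠ 0 := sub_ne_zero.mpr hs
  rw [perronIntegrand, riemannZeta_eq_inv_sub_mul hs]
  field_simp

lemma norm_perronIntegrand {x h : ℝ} {s : ℂ} (hs : s ≠ 1) :
    ‖perronIntegrand x h s‖ = ‖perronKernel x h s‖ / ‖s‖ * (1 / ‖riemannZeta s‖) := by
  rw [perronIntegrand_eq x h hs, norm_div, norm_div]
  ring

lemma norm_perronIntegrand_conj {x h : ℝ} (hx : 0 < x) (hh : 0 ≤ h) {s : ℂ} (hs : s ≠ 1) :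
    ‖perronIntegrand x h (starRingEnd ℂ s)‖ = ‖perronIntegrand x h s‖ := by
  have hs' : starRingEnd ℂ s ≠ 1 := by
    intro h1
    apply hs
    rw [← conj_conj s, h1, map_one]
  rw [norm_perronIntegrand hs, norm_perronIntegrand hs', norm_perronKernel_conj hx hh,
    riemannZeta_conj, norm_conj, norm_conj]

lemma RiemannHypothesis.differentiableAt_perronIntegrand (hRH : RiemannHypothesis) {x h : ℝ}
    (hx : 0 < x) (hh : 0 ≤ h) {s : ℂ} (hs : 1 / 2 < s.re) :
    DifferentiableAt ℂ (perronIntegrand x h) s := by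
  have hs0 : s ≠ 0 := by rintro rfl; norm_num at hs
  have hs1 : s + 1 ≠ 0 := by
    intro h1
    have := congrArg re h1
    simp at this
    linarith
  have hz : riemannZeta₁ s ≠ 0 := by
    rcases eq_or_ne s 1 with rfl | h1
    · simp
    · intro h2
      apply hRH.riemannZeta_ne_zero hs
      rw [riemannZeta_eq_inv_sub_mul h1, h2, mul_zero]
  have hx0 : (x : ℂ) ≠ 0 := by exact_mod_cast hx.ne'
  have hxh : ((x + h : ℝ) : ℂ) ≠ 0 := by exact_mod_cast (by linarith : 0 < x + h).ne'
  have hid : DifferentiableAt ℂ (fun s : ℂ => s + 1) s := by fun_prop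
  -- Writing `1/ζ` as `(s - 1) / riemannZeta₁ s` makes `s = 1` a regular point, so the contour shift
  -- meets no singularity there.
  refine DifferentiableAt.mul (DifferentiableAt.div (DifferentiableAt.div
    ((hid.const_cpow (Or.inl hxh)).sub (hid.const_cpow (Or.inl hx0))) hid hs1)
    differentiableAt_id hs0) (DifferentiableAt.div (by fun_prop)
    (differentiable_riemannZeta₁ s) hz)

lemma add_mul_I_ne_one {σ t : ℝ} (h : t ≠ 0 ∨ σ ≠ 1) : (σ + t * I : ℂ) ≠ 1 := by
  intro h1
  have h2 := congrArg re h1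
  have h3 := congrArg im h1
  simp at h2 h3
  tauto

lemma conj_add_mul_I (σ t : ℝ) : starRingEnd ℂ (σ + t * I) = σ + (-t : ℝ) * I := by
  simp

lemma norm_perronIntegrand_le_of_le {x h σ t ε : ℝ} (hx : 0 < x) (hh : 0 ≤ h) (hσ : 0 ≤ σ)
    (ht : 0 < t) (hζ : 1 / ‖riemannZeta (σ + t * I)‖ ≤ t ^ ε) :
    ‖perronIntegrand x h (σ + t * I)‖ ≤ 2 * (x + h) ^ (σ + 1) * t ^ (ε - 2) := by
  rw [norm_perronIntegrand (add_mul_I_ne_one (Or.inl ht.ne'))]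
  have h1 := norm_perronKernel_le_div hx hh (s := σ + t * I) (by simpa using hσ)
  have h2 := sq_le_norm_mul_add_one (σ + t * I : ℂ)
  have hre : (σ + t * I : ℂ).re = σ := by simp
  have him : (σ + t * I : ℂ).im = t := by simp
  rw [hre] at h1
  rw [him] at h2
  have hs0 : 0 < ‖(σ + t * I : ℂ)‖ := by
    refine norm_pos_iff.mpr fun h0 => ?_
    rw [h0] at him
    simp at him
    linarith
  calc ‖perronKernel x h (σ + t * I)‖ / ‖(σ + t * I : ℂ)‖ * (1 / ‖riemannZeta (σ + t * I)‖)
      ≤ 2 * (x + h) ^ (σ + 1) / ‖(σ + t * I : ℂ) + 1‖ / ‖(σ + t * I : ℂ)‖ * t ^ ε := by gcongr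
    _ = 2 * (x + h) ^ (σ + 1) / (‖(σ + t * I : ℂ)‖ * ‖(σ + t * I : ℂ) + 1‖) * t ^ ε := by
        rw [div_div, mul_comm ‖(σ + t * I : ℂ) + 1‖]
    _ ≤ 2 * (x + h) ^ (σ + 1) / t ^ 2 * t ^ ε := by gcongr
    _ = 2 * (x + h) ^ (σ + 1) * t ^ (ε - 2) := by
        rw [Real.rpow_sub ht, Real.rpow_two]
        ring

lemma norm_perronIntegrand_even {x h : ℝ} (hx : 0 < x) (hh : 0 ≤ h) {σ t : ℝ}
    (hs : t ≠ 0 ∨ σ ≠ 1) :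
    ‖perronIntegrand x h (σ + (-t : ℝ) * I)‖ = ‖perronIntegrand x h (σ + t * I)‖ := by
  rw [← conj_add_mul_I, norm_perronIntegrand_conj hx hh (add_mul_I_ne_one hs)]

lemma RiemannHypothesis.continuous_perronIntegrand (hRH : RiemannHypothesis) {x h σ : ℝ}
    (hx : 0 < x) (hh : 0 ≤ h) (hσ : 1 / 2 < σ) :
    Continuous fun t : ℝ => perronIntegrand x h (σ + t * I) := by
  refine continuous_iff_continuousAt.mpr fun t => ?_
  have h1 := (hRH.differentiableAt_perronIntegrand hx hh (s := σ + t * I) (by simpa using hσ))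
  exact ContinuousAt.comp (f := fun t : ℝ => (σ + t * I : ℂ)) h1.continuousAt (by fun_prop)

lemma RiemannHypothesis.integrable_perronIntegrand (hRH : RiemannHypothesis) {x h σ T₀ ε : ℝ}
    (hx : 0 < x) (hh : 0 ≤ h) (hσ : 1 / 2 < σ) (hσ1 : σ ≠ 1) (hT₀ : 0 < T₀) (hε : ε < 1)
    (hζ : ∀ t : ℝ, T₀ ≤ t → 1 / ‖riemannZeta (σ + t * I)‖ ≤ t ^ ε) :
    Integrable fun t : ℝ => perronIntegrand x h (σ + t * I) :=
  integrable_of_norm_le_rpow (hRH.continuous_perronIntegrand hx hh hσ)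
    (fun _ => norm_perronIntegrand_even hx hh (Or.inr hσ1)) hε hT₀
    (fun t ht => norm_perronIntegrand_le_of_le hx hh (by linarith) (hT₀.trans_le ht) (hζ t ht))

lemma perronIntegrand_two_add_mul_I {x h : ℝ} (t : ℝ) :
    perronIntegrand x h (2 + t * I) =
      ((x + h : ℝ) : ℂ) ^ (2 + t * I + 1) / ((2 + t * I) * (2 + t * I + 1)) /
        riemannZeta (2 + t * I) -
      (x : ℂ) ^ (2 + t * I + 1) / ((2 + t * I) * (2 + t * I + 1)) / riemannZeta (2 + t * I) := by
  rw [perronIntegrand_eq _ _ (by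
    intro h1
    have := congrArg re h1
    simp at this), perronKernel]
  simp only [div_eq_mul_inv, mul_inv]
  ring

lemma integrable_perron {X : ℝ} (hX : 0 < X) :
    Integrable fun t : ℝ => (X : ℂ) ^ (2 + t * I + 1) / ((2 + t * I) * (2 + t * I + 1)) /
        riemannZeta (2 + t * I) := by
  have hX0 : (X : ℂ) ≠ 0 := by exact_mod_cast hX.ne'
  have hne : ∀ t : ℝ, riemannZeta (2 + t * I) ≠ 0 := fun t =>
    riemannZeta_ne_zero_of_one_lt_re (by simp)
  have hζc : Continuous fun t : ℝ => riemannZeta (2 + t * I) := by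
    refine continuous_iff_continuousAt.mpr fun t => ?_
    refine ContinuousAt.comp (f := fun t : ℝ => (2 + t * I : ℂ))
      (differentiableAt_riemannZeta ?_).continuousAt (by fun_prop)
    intro h1
    have := congrArg re h1
    simp at this
  have hζ : ∃ C, ∀ t : ℝ, ‖1 / riemannZeta (2 + t * I)‖ ≤ C := by
    refine ⟨∑' n : ℕ, 1 / (n : ℝ) ^ 2, fun t => ?_⟩
    have hre : 1 < (2 + t * I : ℂ).re := by simp
    have hmul := LSeries_one_mul_Lseries_moebius hre
    rw [LSeries_one_eq_riemannZeta hre] at hmul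
    rw [one_div, ← eq_inv_of_mul_eq_one_right hmul]
    refine tsum_of_norm_bounded (Real.summable_one_div_nat_pow.mpr (by norm_num)).hasSum fun n => ?_
    rw [LSeries.norm_term_eq]
    split_ifs with hn
    · simp [hn]
    · have e : (2 + t * I : ℂ).re = ((2 : ℕ) : ℝ) := by simp
      rw [e, Real.rpow_natCast]
      gcongr
      rw [norm_intCast]
      exact_mod_cast ArithmeticFunction.abs_moebius_le_one
  obtain ⟨C, hC⟩ := hζ
  have h1 : Integrable fun t : ℝ => ((X : ℂ) ^ (2 + t * I + 1) * (1 / riemannZeta (2 + t * I))) *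
      (1 / ((2 + t * I : ℂ) * (2 + t * I + 1))) := by
    refine integrable_one_div_mul_add_one.bdd_mul (c := X ^ (3 : ℝ) * C) ?_ ?_
    · refine Continuous.aestronglyMeasurable (Continuous.mul ?_ (continuous_const.div hζc hne))
      exact Continuous.const_cpow (by fun_prop) (Or.inl hX0)
    · refine Eventually.of_forall fun t => ?_
      rw [norm_mul, norm_cpow_eq_rpow_re_of_pos hX]
      have e : (2 + t * I + 1 : ℂ).re = 3 := by norm_num
      rw [e]
      gcongr
      exact hC t
  refine h1.congr (Eventually.of_forall fun t => ?_)
  simp only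
  ring

lemma integral_perronIntegrand_two {x h : ℝ} (hx : 0 < x) (hh : 0 ≤ h) :
    ∫ t : ℝ, perronIntegrand x h (2 + t * I) =
      2 * Real.pi * (smoothMertens (x + h) - smoothMertens x : ℝ) := by
  simp_rw [perronIntegrand_two_add_mul_I]
  rw [integral_sub (integrable_perron (by linarith)) (integrable_perron hx),
    integral_perron_smoothMertens (by linarith), integral_perron_smoothMertens hx]
  push_cast
  ring

/-- The smoothed Perron formula on a line `Re s = σ₀` with `1/2 < σ₀ < 1`. -/
lemma RiemannHypothesis.integral_perronIntegrand (hRH : RiemannHypothesis) {x h σ₀ T₀ ε : ℝ}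
    (hx : 1 ≤ x) (hh : 0 ≤ h) (hσ₀ : 1 / 2 < σ₀) (hσ₀' : σ₀ < 1) (hT₀ : 0 < T₀) (hε : ε < 1)
    (hζ : ∀ σ t : ℝ, σ₀ ≤ σ → T₀ ≤ t → 1 / ‖riemannZeta (σ + t * I)‖ ≤ t ^ ε) :
    ∫ t : ℝ, perronIntegrand x h (σ₀ + t * I) =
      2 * Real.pi * (smoothMertens (x + h) - smoothMertens x : ℝ) := by
  have hx0 : 0 < x := by linarith
  have hbound : ∀ σ ∈ Icc σ₀ 2, ∀ t : ℝ, T₀ ≤ t →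
      ‖perronIntegrand x h (σ + t * I)‖ ≤ 2 * (x + h) ^ (3 : ℝ) * t ^ (ε - 2) := by
    intro σ hσ t ht
    have ht0 := hT₀.trans_le ht
    refine (norm_perronIntegrand_le_of_le hx0 hh (by linarith [hσ.1]) ht0 (hζ σ t hσ.1 ht)).trans ?_
    gcongr
    · linarith
    · linarith [hσ.2]
  have hω : Tendsto (fun t : ℝ => 2 * (x + h) ^ (3 : ℝ) * t ^ (ε - 2)) atTop (𝓝 0) := by
    have h1 := (tendsto_rpow_neg_atTop (show 0 < 2 - ε by linarith)).const_mul
      (2 * (x + h) ^ (3 : ℝ))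
    simpa using h1
  have h := integral_vertical_eq_of_tendsto (G := perronIntegrand x h) (a := σ₀) (b := 2)
    (by linarith)
    (fun s hs => hRH.differentiableAt_perronIntegrand hx0 hh (by linarith))
    (hRH.integrable_perronIntegrand hx0 hh hσ₀ hσ₀'.ne hT₀ hε fun t ht => hζ σ₀ t le_rfl ht)
    (hRH.integrable_perronIntegrand hx0 hh (by norm_num) (by norm_num) hT₀ hε
      fun t ht => hζ 2 t (by linarith) ht) hω hbound
    (fun σ hσ t ht => by
      rw [norm_perronIntegrand_even hx0 hh (Or.inl (hT₀.trans_le ht).ne')]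
      exact hbound σ hσ t ht)
  rw [← h, ← integral_perronIntegrand_two hx0 hh]
  norm_num

/-! ### Splitting the integral and choosing the parameters -/

lemma RiemannHypothesis.continuous_one_div_norm_riemannZeta (hRH : RiemannHypothesis) {σ₀ : ℝ}
    (hσ₀ : 1 / 2 < σ₀) (hσ₀' : σ₀ < 1) :
    Continuous fun u : ℝ => 1 / ‖riemannZeta (σ₀ + u * I)‖ := by
  refine Continuous.div continuous_const (Continuous.norm ?_) fun u =>
    norm_ne_zero_iff.mpr (hRH.riemannZeta_ne_zero (by simpa using hσ₀))
  refine continuous_iff_continuousAt.mpr fun u => ?_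
  exact ContinuousAt.comp (f := fun u : ℝ => (σ₀ + u * I : ℂ))
    (differentiableAt_riemannZeta (add_mul_I_ne_one (Or.inr hσ₀'.ne))).continuousAt (by fun_prop)

/-- The bound for the smoothed Perron integral obtained by splitting it at `T₁` and `T`. -/
lemma RiemannHypothesis.abs_smoothMertens_sub_le (hRH : RiemannHypothesis) {x h σ₀ T₁ T ε : ℝ}
    (hx : 1 ≤ x) (hh : 0 ≤ h) (hσ₀ : 1 / 2 < σ₀) (hσ₀' : σ₀ < 1) (hT₁ : 0 < T₁) (hT : T₁ ≤ T)
    (hε0 : 0 < ε) (hε : ε < 1)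
    (hζ : ∀ σ t : ℝ, σ₀ ≤ σ → T₁ ≤ t → 1 / ‖riemannZeta (σ + t * I)‖ ≤ t ^ ε) :
    Real.pi * |smoothMertens (x + h) - smoothMertens x| ≤
      h * (x + h) ^ σ₀ / σ₀ * (∫ u in (0 : ℝ)..T₁, 1 / ‖riemannZeta (σ₀ + u * I)‖) +
      h * (x + h) ^ σ₀ * (T ^ ε / ε) +
      2 * (x + h) ^ (σ₀ + 1) * (T ^ (ε - 1) / (1 - ε)) := by
  have hx0 : 0 < x := by linarith
  have hT0 : 0 < T := hT₁.trans_le hT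
  set f : ℝ → ℝ := fun u => ‖perronIntegrand x h (σ₀ + u * I)‖ with hf
  have hfi : Integrable f := (hRH.integrable_perronIntegrand hx0 hh hσ₀ hσ₀'.ne hT₁ hε
    fun t ht => hζ σ₀ t le_rfl ht).norm
  have heven : ∀ t, f |t| = f t := by
    intro t
    rcases abs_choice t with h1 | h1 <;> rw [h1]
    exact norm_perronIntegrand_even hx0 hh (Or.inr hσ₀'.ne)
  -- Conjugation symmetry of the norm reduces to the upper half-line; the factor `2` cancels that in
  -- `2π`.
  have h1 : ∫ t, f t = 2 * ∫ t in Ioi (0 : ℝ), f t := by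
    rw [← integral_comp_abs]
    simp_rw [heven]
  have h2 : 2 * Real.pi * |smoothMertens (x + h) - smoothMertens x| ≤ ∫ t, f t := by
    have h3 := hRH.integral_perronIntegrand hx hh hσ₀ hσ₀' hT₁ hε hζ
    have h4 := norm_integral_le_integral_norm
      (fun t : ℝ => perronIntegrand x h (σ₀ + t * I)) (μ := volume)
    rw [h3, norm_mul, norm_mul, norm_real, norm_real, norm_ofNat,
      Real.norm_of_nonneg Real.pi_pos.le, Real.norm_eq_abs] at h4
    exact h4
  have h5 : ∫ t in Ioi (0 : ℝ), f t = (∫ t in (0 : ℝ)..T₁, f t) + (∫ t in T₁..T, f t) +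
      ∫ t in Ioi T, f t := by
    rw [add_assoc, intervalIntegral.integral_interval_add_Ioi hfi.integrableOn hfi.integrableOn,
      intervalIntegral.integral_interval_add_Ioi hfi.integrableOn hfi.integrableOn]
  have hre : ∀ u : ℝ, (σ₀ + u * I : ℂ).re = σ₀ := fun u => by simp
  have him : ∀ u : ℝ, (σ₀ + u * I : ℂ).im = u := fun u => by simp
  have hker : ∀ u : ℝ, ‖perronKernel x h (σ₀ + u * I)‖ ≤ h * (x + h) ^ σ₀ := fun u => by
    have := norm_perronKernel_le hx0 hh (s := σ₀ + u * I) (by rw [hre]; linarith)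
    rwa [hre] at this
  -- The three ranges use `‖s‖ ≥ σ₀` with `1/|ζ|` kept, then `‖s‖ ≥ u` with `u ^ ε`, then the
  -- decaying kernel bound.
  have hb1 : ∀ u : ℝ, f u ≤ h * (x + h) ^ σ₀ / σ₀ * (1 / ‖riemannZeta (σ₀ + u * I)‖) := by
    intro u
    rw [hf]
    simp only
    rw [norm_perronIntegrand (add_mul_I_ne_one (Or.inr hσ₀'.ne))]
    have h7 : σ₀ ≤ ‖(σ₀ + u * I : ℂ)‖ := by
      have := (le_abs_self _).trans (abs_re_le_norm (σ₀ + u * I : ℂ))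
      rwa [hre] at this
    have := hker u
    have hσp : 0 < σ₀ := by linarith
    gcongr
  have hb2 : ∀ u : ℝ, T₁ ≤ u → f u ≤ h * (x + h) ^ σ₀ * u ^ (ε - 1) := by
    intro u hu
    have hu0 : 0 < u := hT₁.trans_le hu
    rw [hf]
    simp only
    rw [norm_perronIntegrand (add_mul_I_ne_one (Or.inr hσ₀'.ne))]
    have h7 : u ≤ ‖(σ₀ + u * I : ℂ)‖ := by
      have := (le_abs_self _).trans (abs_im_le_norm (σ₀ + u * I : ℂ))
      rwa [him] at this
    have h8 := hker u
    have h9 := hζ σ₀ u le_rfl hu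
    calc ‖perronKernel x h (σ₀ + u * I)‖ / ‖(σ₀ + u * I : ℂ)‖ * (1 / ‖riemannZeta (σ₀ + u * I)‖)
        ≤ h * (x + h) ^ σ₀ / u * u ^ ε := by gcongr
      _ = _ := by rw [Real.rpow_sub hu0, Real.rpow_one]; ring
  have hb3 : ∀ u : ℝ, T ≤ u → f u ≤ 2 * (x + h) ^ (σ₀ + 1) * u ^ (ε - 2) := fun u hu =>
    norm_perronIntegrand_le_of_le hx0 hh (by linarith) (hT0.trans_le hu)
      (hζ σ₀ u le_rfl (hT.trans hu))
  have i1 : ∫ t in (0 : ℝ)..T₁, f t ≤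
      h * (x + h) ^ σ₀ / σ₀ * ∫ u in (0 : ℝ)..T₁, 1 / ‖riemannZeta (σ₀ + u * I)‖ := by
    rw [← intervalIntegral.integral_const_mul]
    exact intervalIntegral.integral_mono_on hT₁.le hfi.intervalIntegrable
      (((hRH.continuous_one_div_norm_riemannZeta hσ₀ hσ₀').const_mul _).intervalIntegrable _ _)
      fun u _ => hb1 u
  have h0 : (0 : ℝ) ∉ uIcc T₁ T := by
    rw [uIcc_of_le hT]; exact fun h => absurd h.1 (not_le.mpr hT₁)
  have i2 : ∫ t in T₁..T, f t ≤ h * (x + h) ^ σ₀ * (T ^ ε / ε) := by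
    have j1 : ∫ t in T₁..T, f t ≤ ∫ u in T₁..T, h * (x + h) ^ σ₀ * u ^ (ε - 1) :=
      intervalIntegral.integral_mono_on hT hfi.intervalIntegrable
        ((intervalIntegral.intervalIntegrable_rpow (Or.inr h0)).const_mul _)
        fun u hu => hb2 u hu.1
    rw [intervalIntegral.integral_const_mul, integral_rpow (Or.inl (by linarith)),
      sub_add_cancel] at j1
    refine j1.trans ?_
    gcongr
    have : 0 ≤ T₁ ^ ε := by positivity
    linarith
  have i3 : ∫ t in Ioi T, f t ≤ 2 * (x + h) ^ (σ₀ + 1) * (T ^ (ε - 1) / (1 - ε)) := by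
    have j1 : ∫ t in Ioi T, f t ≤ ∫ u in Ioi T, 2 * (x + h) ^ (σ₀ + 1) * u ^ (ε - 2) :=
      setIntegral_mono_on hfi.integrableOn
        ((integrableOn_Ioi_rpow_of_lt (by linarith) hT0).const_mul _) measurableSet_Ioi
        fun u hu => hb3 u (le_of_lt hu)
    rw [integral_const_mul, integral_Ioi_rpow_of_lt (by linarith) hT0] at j1
    refine j1.trans (le_of_eq ?_)
    rw [show ε - 2 + 1 = ε - 1 by ring, ← neg_sub 1 ε, neg_div_neg_eq, neg_sub]
  linarith

theorem theorem4p1 (hRH : RiemannHypothesis)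
    (σ₀ C₁ C₂ C₃ T₁ T₂ lam ε₀ : ℝ)
    (hC₁ : 0 < C₁) (hC₁' : C₁ ≤ 1)
    (hC₂ : 0 < C₂) (hC₂' : C₂ ≤ 2 * C₁)
    (hC₃ : 1 ≤ C₃)
    (hσ₀ : 1 / 2 + C₂ / Real.log (Real.log T₁) ≤ σ₀) (hσ₀' : σ₀ < 1)
    (hT₁a : Real.exp (Real.exp (2 * C₂)) ≤ T₁)
    (hT₁b : Real.exp (Real.exp 2) ≤ T₁)
    (hT₁c : C₃ ≤ T₁)
    (hT₁d : Real.exp (Real.exp (1 / (2 * σ₀ - 1))) ≤ T₁)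
    (hT₂ : T₂ ≤ T₁ - C₃ * Real.log (Real.log T₁) - 1 / 2)
    (hT₂' : Real.exp (Real.exp 2) ≤ T₂)
    (hT₁e : 0 ≤ T₁ - 2 * C₃ * Real.log (Real.log T₁))
    (hlam : 0 < lam) (hlam' : lam ≤ T₁)
    (hε₀ : ε₀ = epsZero σ₀ C₁ C₂ C₃ T₁ T₂) (hε₀' : ε₀ < 1) :
    IntervalIntegrable (fun u : ℝ => 1 / ‖riemannZeta (σ₀ + Complex.I * u)‖)
      MeasureTheory.volume 0 T₁ ∧
    ∀ x : ℝ, (T₁ / lam) ^ ((1 + ε₀) / (1 - σ₀)) ≤ x →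
      |mertens x| ≤
        1 +
        (1 / (Real.pi * σ₀) * (1 + lam / T₁) ^ σ₀ *
          ∫ u in (0 : ℝ)..T₁, 1 / ‖riemannZeta (σ₀ + Complex.I * u)‖) * x ^ σ₀ +
        (1 + lam ^ ε₀ / Real.pi * (1 + lam / T₁) ^ σ₀ *
          (1 / ε₀ + 2 / (lam * (1 - ε₀)) * (1 + lam / T₁))) *
          x ^ ((σ₀ + ε₀) / (1 + ε₀)) := by
  have hT0 : 0 < T₁ := (Real.exp_pos _).trans_le hT₁b
  have hl : 0 < Real.log (Real.log T₁) := by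
    have hL2 : Real.exp 2 ≤ Real.log T₁ := (Real.le_log_iff_exp_le hT0).mpr hT₁b
    have := (Real.le_log_iff_exp_le ((Real.exp_pos _).trans_le hL2)).mpr hL2
    linarith
  have hσ : 1 / 2 < σ₀ := by
    have : 0 < C₂ / Real.log (Real.log T₁) := by positivity
    linarith
  have hσ0 : 0 < σ₀ := by linarith
  have hε0 : 0 < ε₀ := hε₀ ▸ epsZero_pos hC₁ hC₁' hC₂ hC₃ hT₂' hT₁b
  have hζ : ∀ σ t : ℝ, σ₀ ≤ σ → T₁ ≤ t → 1 / ‖riemannZeta (σ + t * I)‖ ≤ t ^ ε₀ := by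
    intro σ t h1 h2
    rw [hε₀]
    exact hRH.norm_inv_riemannZeta_le hC₁ hC₁' hC₂ hC₃ hT₂' hT₁b hT₁a hT₁c hT₁d hT₂ hσ₀ hσ₀' h2 h1
  have hcomm : ∀ u : ℝ, (σ₀ + Complex.I * u : ℂ) = σ₀ + u * I := fun u => by ring
  simp_rw [hcomm]
  refine ⟨(hRH.continuous_one_div_norm_riemannZeta hσ hσ₀').intervalIntegrable _ _,
    fun x hx => ?_⟩
  have hq : 1 ≤ T₁ / lam := by rw [le_div_iff₀ hlam]; linarith
  have hx1 : 1 ≤ x := (Real.one_le_rpow hq (div_nonneg (by linarith) (by linarith))).trans hx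
  have hx0 : 0 < x := by linarith
  -- The exponents of `h` and `T` solve `hT = λx` and `x ^ σ₀ T ^ ε₀ = λ ^ ε₀ h`. The lower bound on
  -- `x` is exactly what `T ≥ T₁` requires.
  set h : ℝ := x ^ ((σ₀ + ε₀) / (1 + ε₀)) with hh
  have hh0 : 0 < h := by positivity
  set T : ℝ := lam * x ^ ((1 - σ₀) / (1 + ε₀)) with hT
  have hTT : T₁ ≤ T := by
    have h1 : T₁ / lam ≤ x ^ ((1 - σ₀) / (1 + ε₀)) := by
      have h2 := Real.rpow_le_rpow (by positivity) hx
        (show 0 ≤ (1 - σ₀) / (1 + ε₀) from div_nonneg (by linarith) (by linarith))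
      rw [← Real.rpow_mul (by positivity)] at h2
      have h3 : (1 + ε₀) / (1 - σ₀) * ((1 - σ₀) / (1 + ε₀)) = 1 := by
        have : 1 - σ₀ ≠ 0 := by linarith
        field_simp
      rwa [h3, Real.rpow_one] at h2
    rw [div_le_iff₀ hlam] at h1
    linarith
  have hTpos : 0 < T := hT0.trans_le hTT
  have hhT : h * T = lam * x := by
    rw [hh, hT, mul_left_comm, ← Real.rpow_add hx0]
    have : (σ₀ + ε₀) / (1 + ε₀) + (1 - σ₀) / (1 + ε₀) = 1 := by field_simp; ring
    rw [this, Real.rpow_one]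
  have hxh : x + h = x * (1 + lam / T) := by
    field_simp
    linarith
  have hxT : x ^ σ₀ * T ^ ε₀ = lam ^ ε₀ * h := by
    rw [hT, Real.mul_rpow hlam.le (by positivity), ← Real.rpow_mul hx0.le, mul_left_comm,
      ← Real.rpow_add hx0, hh]
    congr 2
    field_simp
    ring
  set J := ∫ u in (0 : ℝ)..T₁, 1 / ‖riemannZeta (σ₀ + u * I)‖ with hJ
  have hJ0 : 0 ≤ J := intervalIntegral.integral_nonneg hT0.le fun u _ => by positivity
  set B := (1 + lam / T₁) ^ σ₀ with hB
  have hlT : lam / T ≤ lam / T₁ := by gcongr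
  have hpow : (x + h) ^ σ₀ ≤ B * x ^ σ₀ := by
    rw [hxh, Real.mul_rpow hx0.le (by positivity), mul_comm, hB]
    gcongr
  -- The tail lacks the factor `h`; it is recovered from `(x + h) / T = h (1 + λ/T) / λ`.
  have hpow1 : (x + h) ^ (σ₀ + 1) * T ^ (ε₀ - 1) =
      h * ((x + h) ^ σ₀ * T ^ ε₀ * ((1 + lam / T) / lam)) := by
    rw [Real.rpow_add (by positivity), Real.rpow_one, Real.rpow_sub hTpos, Real.rpow_one]
    have : (x + h) / T = h * ((1 + lam / T) / lam) := by
      rw [hxh]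
      field_simp
      linarith
    calc (x + h) ^ σ₀ * (x + h) * (T ^ ε₀ / T) = (x + h) ^ σ₀ * T ^ ε₀ * ((x + h) / T) := by ring
      _ = _ := by rw [this]; ring
  have hmain := hRH.abs_smoothMertens_sub_le hx1 hh0.le hσ hσ₀' hT0 hTT hε0 hε₀' hζ
  rw [← hJ] at hmain
  have hM := abs_mul_mertens_sub_le hx0.le hh0.le
  have h1e : 0 < 1 - ε₀ := by linarith
  have hxTB : (x + h) ^ σ₀ * T ^ ε₀ ≤ B * (lam ^ ε₀ * h) := by
    rw [← hxT, ← mul_assoc]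
    gcongr
  have hS : |smoothMertens (x + h) - smoothMertens x| ≤ h * (1 / (Real.pi * σ₀) * B * J * x ^ σ₀ +
      lam ^ ε₀ / Real.pi * B * (1 / ε₀ + 2 / (lam * (1 - ε₀)) * (1 + lam / T₁)) * h) := by
    rw [← mul_le_mul_iff_right₀ Real.pi_pos]
    refine hmain.trans ?_
    have a1 : h * (x + h) ^ σ₀ / σ₀ * J ≤ h * (B * x ^ σ₀) / σ₀ * J := by gcongr
    have a2 : h * (x + h) ^ σ₀ * (T ^ ε₀ / ε₀) ≤ h * (B * (lam ^ ε₀ * h)) / ε₀ := by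
      rw [show h * (x + h) ^ σ₀ * (T ^ ε₀ / ε₀) = h * ((x + h) ^ σ₀ * T ^ ε₀) / ε₀ by ring]
      gcongr
    have a3 : 2 * (x + h) ^ (σ₀ + 1) * (T ^ (ε₀ - 1) / (1 - ε₀)) ≤
        2 * (h * (B * (lam ^ ε₀ * h) * ((1 + lam / T₁) / lam))) / (1 - ε₀) := by
      rw [show 2 * (x + h) ^ (σ₀ + 1) * (T ^ (ε₀ - 1) / (1 - ε₀)) =
        2 * ((x + h) ^ (σ₀ + 1) * T ^ (ε₀ - 1)) / (1 - ε₀) by ring, hpow1]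
      gcongr
    refine (add_le_add_three a1 a2 a3).trans (le_of_eq ?_)
    have := Real.pi_pos.ne'
    have := h1e.ne'
    field_simp
    ring
  have hfin : h * |mertens x| ≤ h * (h + 1) + |smoothMertens (x + h) - smoothMertens x| := by
    have := abs_sub_abs_le_abs_sub (h * mertens x) (smoothMertens (x + h) - smoothMertens x)
    rw [abs_mul, abs_of_pos hh0] at this
    linarith
  -- After multiplication by `h`, the error `h(h + 1)` supplies the leading `1` and the `1` inside
  -- the last coefficient.
  rw [← mul_le_mul_iff_right₀ hh0]
  refine hfin.trans ?_
  nlinarith [hS]
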